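/- **The game.** Let $t$ be a rooted, locally finite tree whose edges, directed away from the root, carry weights in $\{-1,0,1\}$. Two players with initial capitals $i$ and $j$ move a token alternately, starting from the root; the first player ($P_1$, with capital $i$) makes the first move. A move takes the token from its current vertex $u$ to a child $v$ of $u$ and adds the weight of the edge $(u,v)$ to the capital of the player who moves. A player wins as soon as her capital equals $\kappa$ or her opponent's capital equals $0$; if neither of these has happened and the player whose turn it is cannot move because the token is at a leaf, then her opponent wins. The tree and its weights are known to both players. The game on $t$ is won by $P_1$ (lost by $P_1$) if $P_1$ (respectively her opponent) has a strategy that makes her win after finitely many moves whatever the other player does, and it is a draw if neither player has such a strategy. Let $p_{-1},p_0,p_1\geqslant 0$ with $p_{-1}+p_0+p_1=1$. Let $T$ be the rooted Galton–Watson tree with offspring distribution $\chi$, with i.i.d. edge-weights, independent of the tree, that equal $s$ with probability $p_s$ for $s\in\{-1,0,1\}$. Let $d_{i,j}$ be the probability that the game on $T$, with initial capitals $i,j$ and target capital $\kappa$, is a draw. **Theorem.** Let $\kappa=2$. 1. If $\chi$ is Binomial$(d,\pi)$ with $d\in\mathbb N$, $d\geqslant 2$ and $0<\pi\leqslant 1$,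 then $d_{1,1}=0$ if and only if $$(1-p_{-1}-p_1)\,\pi\,(1-\pi p_1)^{d-1}\leqslant \frac{(d+1)^{d-1}}{d^{d}}.$$ 2. If $\chi$ is Poisson$(\lambda)$ with $\lambda>0$, then $d_{1,1}=0$ if and only if $$(1-p_{-1}-p_1)\,\lambda\, e^{-\lambda p_1}\leqslant e.$$ 3. If $\chi$ is Negative Binomial$(r,\pi)$ with $r\in\mathbb N$, $r\geqslant 1$ and $0<\pi\leqslant 1$ (the number of failures before the $r$-th success in independent trials with success probability $\pi$), then $d_{1,1}=0$ if and only if $$(r-1)^{r+1}(1-\pi)(1-p_{-1}-p_1)\,\pi^{r}\leqslant (p_1+\pi-p_1\pi)^{r+1}\,r^{r}.$$ 4. If $\chi(0)=1-\pi$ and $\chi(d)=\pi$ with $0<\pi<1$ and $d\in\mathbb N$, $d\geqslant 2$, then $d_{1,1}=0$ if and only if $$(1-p_{-1}-p_1)\,\pi\,\{\pi(1-p_1)+p_{-1}(1-\pi)\}^{d-1}\leqslant \frac{(d+1)^{d-1}}{d^{d}}.$$ -/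

import Mathlib

open MeasureTheory ProbabilityTheory

instance SignType.instMeasurableSpaceTop : MeasurableSpace SignType := ⊤

instance SignType.instDiscreteMeasurableSpaceTop : DiscreteMeasurableSpace SignType :=
  ⟨fun _ => trivial⟩

namespace PercolationGame

/-! ### Rooted edge-weighted trees

Vertices are finite words over `ℕ` (Ulam–Harris labelling): the root is `[]`, and the children of a
vertex `u` are `u ++ [k]` for `k` smaller than the number of children of `u`. -/

/-- A rooted, locally finite tree with edge-weights in `{-1, 0, 1}`. At a word `u` it records the
number of children of `u` and the weight of the edge that leads from the parent of `u` to `u`.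
(The weight recorded at the root, and the data at words that are not vertices, play no role.) -/
abbrev WeightedTree : Type := List ℕ → ℕ × SignType

/-- The number of children of `u` in `t`. -/
def numChildren (t : WeightedTree) (u : List ℕ) : ℕ := (t u).1

/-- The weight of the edge from the parent of `u` to `u`. -/
def edgeWeight (t : WeightedTree) (u : List ℕ) : ℤ := ((t u).2 : ℤ)

/-! ### The game on a deterministic tree -/

/-- A position of the game: the vertex at which the token is, whether it is the turn of player 1,
and the current capitals of the two players. -/
structure Position where
  vertex : List ℕ
  firstToMove : Bool
  capital₁ : ℤ
  capital₂ : ℤ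

/-- The initial position: the token is at `v`, player 1 has capital `i`, player 2 has capital `j`,
and player 1 makes the first move. -/
def startPosition (v : List ℕ) (i j : ℕ) : Position := ⟨v, true, i, j⟩

/-- Player 1 has won at the position: she has amassed the target capital `κ`, or the capital of her
opponent has dwindled to `0`, or (neither player having won through the capitals) player 2 is to
move from a leaf. -/
def HasWon₁ (κ : ℕ) (t : WeightedTree) (P : Position) : Prop :=
  P.capital₁ = κ ∨ P.capital₂ = 0 ∨
    (P.capital₁ ≠ 0 ∧ P.capital₂ ≠ κ ∧ P.firstToMove = false ∧ numChildren t P.vertex = 0)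

/-- Player 2 has won at the position. -/
def HasWon₂ (κ : ℕ) (t : WeightedTree) (P : Position) : Prop :=
  P.capital₂ = κ ∨ P.capital₁ = 0 ∨
    (P.capital₂ ≠ 0 ∧ P.capital₁ ≠ κ ∧ P.firstToMove = true ∧ numChildren t P.vertex = 0)

/-- A strategy picks a child at every vertex that has one. The path from the initial vertex
to the current one is the whole history of the game, so a choice that depends on the vertex alone
may depend on the history. -/
def IsStrategy (t : WeightedTree) (σ : List ℕ → ℕ) : Prop :=
  ∀ u, 0 < numChildren t u → σ u < numChildren t u

/-- The player whose turn it is moves the token to the child picked by her strategy (`σ₁` for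
player 1, `σ₂` for player 2) and the weight of the traversed edge is added to her capital. -/
def move (t : WeightedTree) (σ₁ σ₂ : List ℕ → ℕ) (P : Position) : Position :=
  match P.firstToMove with
  | true =>
    let v := P.vertex ++ [σ₁ P.vertex]
    ⟨v, false, P.capital₁ + edgeWeight t v, P.capital₂⟩
  | false =>
    let v := P.vertex ++ [σ₂ P.vertex]
    ⟨v, true, P.capital₁, P.capital₂ + edgeWeight t v⟩

/-- The position after `n` moves (of no significance once a player has won). -/
def positionAfter (t : WeightedTree) (σ₁ σ₂ : List ℕ → ℕ) (P : Position) (n : ℕ) : Position :=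
  (move t σ₁ σ₂)^[n] P

/-- When the two strategies are played from `P`, the game ends, and player 1 wins it. -/
def PlayWonBy₁ (κ : ℕ) (t : WeightedTree) (σ₁ σ₂ : List ℕ → ℕ) (P : Position) : Prop :=
  ∃ n, HasWon₁ κ t (positionAfter t σ₁ σ₂ P n) ∧
    ∀ m < n, ¬ HasWon₁ κ t (positionAfter t σ₁ σ₂ P m) ∧
      ¬ HasWon₂ κ t (positionAfter t σ₁ σ₂ P m)

/-- When the two strategies are played from `P`, the game ends, and player 2 wins it. -/
def PlayWonBy₂ (κ : ℕ) (t : WeightedTree) (σ₁ σ₂ : List ℕ → ℕ) (P : Position) : Prop :=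
  ∃ n, HasWon₂ κ t (positionAfter t σ₁ σ₂ P n) ∧
    ∀ m < n, ¬ HasWon₁ κ t (positionAfter t σ₁ σ₂ P m) ∧
      ¬ HasWon₂ κ t (positionAfter t σ₁ σ₂ P m)

/-- Player 1 wins the game with initial capitals `i`, `j`, target capital `κ` and initial vertex
`v`: she has a winning strategy. -/
def FirstPlayerWins (i j κ : ℕ) (t : WeightedTree) (v : List ℕ) : Prop :=
  ∃ σ₁, IsStrategy t σ₁ ∧ ∀ σ₂, IsStrategy t σ₂ → PlayWonBy₁ κ t σ₁ σ₂ (startPosition v i j)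

/-- Player 1 loses the game: player 2 has a winning strategy. -/
def FirstPlayerLoses (i j κ : ℕ) (t : WeightedTree) (v : List ℕ) : Prop :=
  ∃ σ₂, IsStrategy t σ₂ ∧ ∀ σ₁, IsStrategy t σ₁ → PlayWonBy₂ κ t σ₁ σ₂ (startPosition v i j)

/-- The game is a draw: neither player has a winning strategy. -/
def IsDraw (i j κ : ℕ) (t : WeightedTree) (v : List ℕ) : Prop :=
  ¬ FirstPlayerWins i j κ t v ∧ ¬ FirstPlayerLoses i j κ t v

/-! ### The random tree -/

/-- The probabilities `p₋₁`, `p₀`, `p₁` of the edge-weights `-1`, `0`, `1`. -/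
structure EdgeProbabilities where
  neg : ℝ
  zero : ℝ
  pos : ℝ
  neg_nonneg : 0 ≤ neg
  zero_nonneg : 0 ≤ zero
  pos_nonneg : 0 ≤ pos
  sum_eq_one : neg + zero + pos = 1

/-- The distribution of an edge-weight. -/
noncomputable def edgeLaw (p : EdgeProbabilities) : Measure SignType :=
  ENNReal.ofReal p.neg • Measure.dirac (-1) + ENNReal.ofReal p.zero • Measure.dirac 0 +
    ENNReal.ofReal p.pos • Measure.dirac 1

instance isProbabilityMeasure_edgeLaw (p : EdgeProbabilities) :
    IsProbabilityMeasure (edgeLaw p) := by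
  constructor
  simp only [edgeLaw, Measure.add_apply, Measure.smul_apply, measure_univ, smul_eq_mul, mul_one]
  rw [← ENNReal.ofReal_add p.neg_nonneg p.zero_nonneg,
    ← ENNReal.ofReal_add (add_nonneg p.neg_nonneg p.zero_nonneg) p.pos_nonneg, p.sum_eq_one,
    ENNReal.ofReal_one]

/-- The law of the edge-weighted Galton–Watson tree with offspring distribution `χ`: all the numbers
of children are distributed as `χ`, all the edge-weights have the probabilities `p`, and all of
these are independent. -/
noncomputable def galtonWatsonLaw (χ : Measure ℕ) (p : EdgeProbabilities) : Measure WeightedTree :=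
  Measure.infinitePi fun _ : List ℕ => χ.prod (edgeLaw p)

/-- The probability `d_{i,j}` that the game with target capital `κ` and initial capitals `i`, `j`,
started at the root of the edge-weighted Galton–Watson tree, is a draw. -/
noncomputable def drawProbability (χ : Measure ℕ) (p : EdgeProbabilities) (κ i j : ℕ) : ℝ :=
  (galtonWatsonLaw χ p).real {t | IsDraw i j κ t []}

/-- The negative binomial distribution: the number of failures before the `r`-th success in
independent trials with success probability `π`. -/
noncomputable def negativeBinomial (r : ℕ) (π : unitInterval) : Measure ℕ :=
  Measure.sum fun k : ℕ =>
    ENNReal.ofReal (((k + r - 1).choose k : ℝ) * (π : ℝ) ^ r * (1 - (π : ℝ)) ^ k) •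
      Measure.dirac k

theorem isProbabilityMeasure_negativeBinomial (r : ℕ) (hr : 1 ≤ r) (π : unitInterval)
    (hπ : 0 < (π : ℝ)) : IsProbabilityMeasure (negativeBinomial r π) := by
  have h1 : (π : ℝ) ≤ 1 := π.2.2
  have hs : HasSum (fun k : ℕ => ((k + r - 1).choose k : ℝ) * (π : ℝ) ^ r * (1 - (π : ℝ)) ^ k) 1 := by
    obtain ⟨s, rfl⟩ : ∃ s, r = s + 1 := ⟨r - 1, by omega⟩
    have h := (hasSum_choose_mul_geometric_of_norm_lt_one s (r := 1 - (π : ℝ))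
      (by rw [Real.norm_eq_abs, abs_lt]; constructor <;> linarith)).mul_left ((π : ℝ) ^ (s + 1))
    have hv : (π : ℝ) ^ (s + 1) * (1 / (1 - (1 - (π : ℝ))) ^ (s + 1)) = 1 := by
      rw [sub_sub_cancel, mul_one_div_cancel]
      positivity
    rw [hv] at h
    convert! h using 2 with k
    have hc : (k + (s + 1) - 1).choose k = (k + s).choose s := by
      rw [show k + (s + 1) - 1 = k + s by omega, Nat.choose_symm_add]
    rw [hc]
    ring
  exact hs.isProbabilityMeasure_sum_dirac fun k =>
    mul_nonneg (by positivity) (pow_nonneg (by linarith) _)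

end PercolationGame

-- With target 2 and both capitals 1, the first edge of nonzero weight ends the game: weight 1 makes
-- the mover win, weight -1 makes her lose. An edge of weight 0 restores capitals 1, 1 with the
-- roles exchanged. So the game is a win/lose recursion on subtrees, with levels `winSet n` and
-- `loseSet n`; playing good moves at decreasing level, or for ever avoiding bad ones, gives
-- `firstPlayerWins_iff` and `firstPlayerLoses_iff`.
--
-- Let G be the offspring generating function and Φ(x) = 1 - G(p₋₁ + p₀ x), an antitone map of
-- [0,1]. By the branching property (`map_graft_galtonWatsonLaw`) the level probabilities w_n, l_n
-- satisfy w_{n+1} = Φ(1 - l_n) and 1 - l_{n+1} = Φ(w_n), starting from 0 and 1. In the limit Φ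
-- exchanges w and 1 - l, and the draw probability is (1 - l) - w. Since every 2-cycle of Φ stays
-- between w_n and 1 - l_n, draws are negligible exactly when Φ has no 2-cycle of distinct points
-- (`drawProbability_eq_zero_iff`).
--
-- A change of variable turns Φ into v ↦ a - b v^d (binomial and two-point offspring), U ↦ c exp(-U)
-- (Poisson) or s ↦ 1 / (A + C s^r) (negative binomial). In the two algebraic cases, subtract the
-- equations of a 2-cycle and divide by the difference of its points. With h_k the complete
-- homogeneous polynomial, this leaves b h_{d-1} = 1 and a h_{d-1} = h_d, hence b a^{d-1} =
-- h_d^{d-1} / h_{d-1}^d, a function of the ratio of the two points alone; similarly A^{r+1} / C = s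
-- t h_{r-2}^{r+1} / h_{r-1}^r. The threshold is the value at ratio 1, where h_k = k + 1. It is
-- never attained at another ratio because the means h_k / (k + 1) are strictly log-convex in k
-- (`homogeneousMean_sq_lt`), and the intermediate value theorem realises every admissible value
-- beyond it. The Poisson case rests on the monotonicity of x log x - 2x + log x and, conversely, on
-- the instability of the fixed point when c > e.

namespace PercolationGame

/-! ### Subtrees and the sets of trees decided within a given number of moves -/

/-- The weighted tree formed by `u` and its descendants. -/
def subtree (t : WeightedTree) (u : List ℕ) : WeightedTree := fun w => t (u ++ w)

theorem subtree_append (t : WeightedTree) (u v : List ℕ) :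
    subtree t (u ++ v) = subtree (subtree t u) v := by
  funext w
  simp [subtree]

theorem numChildren_subtree (t : WeightedTree) (u : List ℕ) :
    numChildren (subtree t u) [] = numChildren t u := by
  simp [numChildren, subtree]

theorem subtree_apply_nil (t : WeightedTree) (u : List ℕ) : subtree t u [] = t u := by
  simp [subtree]

/-- The trees to which it is good to move from their parent when the player to move loses
precisely on `L`: the edge that leads to the root has weight `1`, or it has weight `0` and the tree
belongs to `L`. -/
def goodMoves (L : Set WeightedTree) : Set WeightedTree :=
  {s | (s []).2 = 1 ∨ ((s []).2 = 0 ∧ s ∈ L)}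

/-- The trees to which it is bad to move from their parent when the player to move wins
precisely on `W`. -/
def badMoves (W : Set WeightedTree) : Set WeightedTree :=
  {s | (s []).2 = -1 ∨ ((s []).2 = 0 ∧ s ∈ W)}

theorem goodMoves_mono {L L' : Set WeightedTree} (h : L ⊆ L') : goodMoves L ⊆ goodMoves L' :=
  fun _ hs => hs.imp_right fun hs => ⟨hs.1, h hs.2⟩

theorem badMoves_mono {W W' : Set WeightedTree} (h : W ⊆ W') : badMoves W ⊆ badMoves W' :=
  fun _ hs => hs.imp_right fun hs => ⟨hs.1, h hs.2⟩

mutual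

/-- The trees on which the player to move, when both capitals are `1` and the target is `2`, can
force a win within `n` moves. -/
def winSet : ℕ → Set WeightedTree
  | 0 => ∅
  | n + 1 => {t | ∃ k < numChildren t [], subtree t [k] ∈ goodMoves (loseSet n)}

/-- The trees on which the opponent of the player to move can force a win within `n` moves. -/
def loseSet : ℕ → Set WeightedTree
  | 0 => ∅
  | n + 1 => {t | ∀ k < numChildren t [], subtree t [k] ∈ badMoves (winSet n)}

end

theorem mem_winSet_succ {n : ℕ} {t : WeightedTree} : t ∈ winSet (n + 1) ↔
    ∃ k < numChildren t [], subtree t [k] ∈ goodMoves (loseSet n) := by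
  simp [winSet]

theorem mem_loseSet_succ {n : ℕ} {t : WeightedTree} : t ∈ loseSet (n + 1) ↔
    ∀ k < numChildren t [], subtree t [k] ∈ badMoves (winSet n) := by
  simp [loseSet]

theorem winSet_zero : winSet 0 = ∅ := by simp [winSet]

theorem loseSet_zero : loseSet 0 = ∅ := by simp [loseSet]

theorem winSet_loseSet_subset_succ (n : ℕ) :
    winSet n ⊆ winSet (n + 1) ∧ loseSet n ⊆ loseSet (n + 1) := by
  induction n with
  | zero => simp [winSet_zero, loseSet_zero]
  | succ n ih =>
    constructor
    · intro t ht
      obtain ⟨k, hk, h⟩ := mem_winSet_succ.1 ht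
      exact mem_winSet_succ.2 ⟨k, hk, goodMoves_mono ih.2 h⟩
    · intro t ht
      exact mem_loseSet_succ.2 fun k hk => badMoves_mono ih.1 (mem_loseSet_succ.1 ht k hk)

theorem monotone_winSet : Monotone winSet :=
  monotone_nat_of_le_succ fun n => (winSet_loseSet_subset_succ n).1

theorem monotone_loseSet : Monotone loseSet :=
  monotone_nat_of_le_succ fun n => (winSet_loseSet_subset_succ n).2

theorem disjoint_goodMoves_badMoves {L W : Set WeightedTree} (h : Disjoint W L) :
    Disjoint (goodMoves L) (badMoves W) := by
  rw [Set.disjoint_left] at h ⊢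
  rintro s (h1 | ⟨h1, hL⟩) (h2 | ⟨h2, hW⟩)
  · rw [h1] at h2; cases h2
  · rw [h1] at h2; cases h2
  · rw [h1] at h2; cases h2
  · exact h hW hL

/-- At equal levels a good move would also have to be bad; monotonicity lifts different levels to
their maximum. -/
theorem disjoint_winSet_loseSet (n m : ℕ) : Disjoint (winSet n) (loseSet m) := by
  have key : ∀ n, Disjoint (winSet n) (loseSet n) := by
    intro n
    induction n with
    | zero => simp [winSet_zero]
    | succ n ih =>
      rw [Set.disjoint_left]
      intro t hW hL
      obtain ⟨k, hk, h⟩ := mem_winSet_succ.1 hW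
      exact Set.disjoint_left.1 (disjoint_goodMoves_badMoves ih) h (mem_loseSet_succ.1 hL k hk)
  exact (key (max n m)).mono (monotone_winSet (le_max_left n m))
    (monotone_loseSet (le_max_right n m))

/-- A tree that is not lost by the player to move allows a move that is not bad. -/
theorem exists_not_mem_badMoves {t : WeightedTree} (h : t ∉ ⋃ n, loseSet n) :
    ∃ k < numChildren t [], subtree t [k] ∉ badMoves (⋃ n, winSet n) := by
  by_contra! hall
  have hn : ∀ k, ∃ n, k < numChildren t [] → subtree t [k] ∈ badMoves (winSet n) := by
    intro k
    by_cases hk : k < numChildren t []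
    · rcases hall k hk with h1 | ⟨h0, hW⟩
      · exact ⟨0, fun _ => Or.inl h1⟩
      · obtain ⟨n, hn⟩ := Set.mem_iUnion.1 hW
        exact ⟨n, fun _ => Or.inr ⟨h0, hn⟩⟩
    · exact ⟨0, fun h' => absurd h' hk⟩
  choose f hf using hn
  -- Local finiteness: the finitely many children have a common bound on the number of moves.
  refine h (Set.mem_iUnion.2 ⟨(Finset.range (numChildren t [])).sup f + 1,
    mem_loseSet_succ.2 fun k hk => ?_⟩)
  exact badMoves_mono (monotone_winSet (Finset.le_sup (Finset.mem_range.2 hk))) (hf k hk)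

/-- A tree that is not won by the player to move allows no good move. -/
theorem not_mem_goodMoves {t : WeightedTree} (h : t ∉ ⋃ n, winSet n) {k : ℕ}
    (hk : k < numChildren t []) : subtree t [k] ∉ goodMoves (⋃ n, loseSet n) := by
  rintro (h1 | ⟨h0, hL⟩)
  · exact h (Set.mem_iUnion.2 ⟨1, mem_winSet_succ.2 ⟨k, hk, Or.inl h1⟩⟩)
  · obtain ⟨n, hn⟩ := Set.mem_iUnion.1 hL
    exact h (Set.mem_iUnion.2 ⟨n + 1, mem_winSet_succ.2 ⟨k, hk, Or.inr ⟨h0, hn⟩⟩⟩)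

/-! ### Plays between positions in which both capitals are `1` -/

/-- The player `q` (`true` for player 1) has won at the position, when the target is `2`. -/
def HasWon (q : Bool) (t : WeightedTree) (P : Position) : Prop :=
  match q with
  | true => HasWon₁ 2 t P
  | false => HasWon₂ 2 t P

/-- The player `q` wins the play from `P` after exactly `n` moves. -/
def PlayWonIn (n : ℕ) (q : Bool) (t : WeightedTree) (σ : Bool → List ℕ → ℕ) (P : Position) :
    Prop :=
  HasWon q t (positionAfter t (σ true) (σ false) P n) ∧
    ∀ m < n, ∀ r, ¬ HasWon r t (positionAfter t (σ true) (σ false) P m)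

theorem playWonIn_zero {q : Bool} {t : WeightedTree} {σ : Bool → List ℕ → ℕ} {P : Position} :
    PlayWonIn 0 q t σ P ↔ HasWon q t P := by
  simp [PlayWonIn, positionAfter]

theorem playWonIn_succ {n : ℕ} {q : Bool} {t : WeightedTree} {σ : Bool → List ℕ → ℕ}
    {P : Position} : PlayWonIn (n + 1) q t σ P ↔
      (∀ r, ¬ HasWon r t P) ∧ PlayWonIn n q t σ (move t (σ true) (σ false) P) := by
  simp only [PlayWonIn, positionAfter, Function.iterate_succ_apply]
  constructor
  · rintro ⟨h1, h2⟩
    exact ⟨h2 0 (by omega), h1, fun m hm => h2 (m + 1) (by omega)⟩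
  · rintro ⟨h0, h1, h2⟩
    refine ⟨h1, fun m hm => ?_⟩
    cases m with
    | zero => exact h0
    | succ m => exact h2 m (by omega)

theorem playWonBy₁_iff {t : WeightedTree} {σ : Bool → List ℕ → ℕ} {P : Position} :
    PlayWonBy₁ 2 t (σ true) (σ false) P ↔ ∃ n, PlayWonIn n true t σ P := by
  simp [PlayWonBy₁, PlayWonIn, HasWon, and_comm]

theorem playWonBy₂_iff {t : WeightedTree} {σ : Bool → List ℕ → ℕ} {P : Position} :
    PlayWonBy₂ 2 t (σ true) (σ false) P ↔ ∃ n, PlayWonIn n false t σ P := by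
  simp [PlayWonBy₂, PlayWonIn, HasWon, and_comm]

/-- The position at `u` in which both capitals are `1` and `b` is to move. -/
def evenPosition (u : List ℕ) (b : Bool) : Position := ⟨u, b, 1, 1⟩

theorem hasWon_evenPosition {q b : Bool} {t : WeightedTree} {u : List ℕ} :
    HasWon q t (evenPosition u b) ↔ q = !b ∧ numChildren t u = 0 := by
  cases q <;> cases b <;> simp [HasWon, HasWon₁, HasWon₂, evenPosition]

theorem not_hasWon_evenPosition {b : Bool} {t : WeightedTree} {u : List ℕ} :
    (∀ r, ¬ HasWon r t (evenPosition u b)) ↔ 0 < numChildren t u := by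
  simp [hasWon_evenPosition, Nat.pos_iff_ne_zero]

theorem move_evenPosition_of_zero {b : Bool} {t : WeightedTree} {σ : Bool → List ℕ → ℕ}
    {u : List ℕ} (h : (t (u ++ [σ b u])).2 = 0) :
    move t (σ true) (σ false) (evenPosition u b) = evenPosition (u ++ [σ b u]) (!b) := by
  cases b <;> simp [move, evenPosition, edgeWeight, h]

theorem hasWon_move_of_pos {b q : Bool} {t : WeightedTree} {σ : Bool → List ℕ → ℕ}
    {u : List ℕ} (h : (t (u ++ [σ b u])).2 = 1) :
    HasWon q t (move t (σ true) (σ false) (evenPosition u b)) ↔ q = b := by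
  cases b <;> cases q <;> simp [HasWon, HasWon₁, HasWon₂, move, evenPosition, edgeWeight, h]

theorem hasWon_move_of_neg {b q : Bool} {t : WeightedTree} {σ : Bool → List ℕ → ℕ}
    {u : List ℕ} (h : (t (u ++ [σ b u])).2 = -1) :
    HasWon q t (move t (σ true) (σ false) (evenPosition u b)) ↔ q = !b := by
  cases b <;> cases q <;> simp [HasWon, HasWon₁, HasWon₂, move, evenPosition, edgeWeight, h]

/-! ### Optimal strategies -/

/-- From a tree won by the player to move, the strategy makes a good move. -/
def IsAttack (t : WeightedTree) (s : List ℕ → ℕ) : Prop :=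
  ∀ u n, subtree t u ∈ winSet (n + 1) → subtree t (u ++ [s u]) ∈ goodMoves (loseSet n)

/-- From a tree that is not lost by the player to move, the strategy makes a move that is not
bad. -/
def IsDefence (t : WeightedTree) (s : List ℕ → ℕ) : Prop :=
  ∀ u, subtree t u ∉ ⋃ n, loseSet n → subtree t (u ++ [s u]) ∉ badMoves (⋃ n, winSet n)

theorem exists_isStrategy_isAttack (t : WeightedTree) : ∃ s, IsStrategy t s ∧ IsAttack t s := by
  have h : ∀ u, ∃ k, (0 < numChildren t u → k < numChildren t u) ∧
      ∀ n, subtree t u ∈ winSet (n + 1) → subtree t (u ++ [k]) ∈ goodMoves (loseSet n) := by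
    intro u
    classical
    by_cases hu : ∃ n, subtree t u ∈ winSet (n + 1)
    -- One child has to serve all levels at once: a good move for the least level is good for all
    -- higher ones.
    · obtain ⟨k, hk, hgood⟩ := mem_winSet_succ.1 (Nat.find_spec hu)
      rw [numChildren_subtree] at hk
      rw [← subtree_append] at hgood
      exact ⟨k, fun _ => hk, fun n hn =>
        goodMoves_mono (monotone_loseSet (Nat.find_min' hu hn)) hgood⟩
    · exact ⟨0, id, fun n hn => absurd ⟨n, hn⟩ hu⟩
  choose s hs using h
  exact ⟨s, fun u => (hs u).1, fun u => (hs u).2⟩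

theorem exists_isStrategy_isDefence (t : WeightedTree) :
    ∃ s, IsStrategy t s ∧ IsDefence t s := by
  have h : ∀ u, ∃ k, (0 < numChildren t u → k < numChildren t u) ∧
      (subtree t u ∉ ⋃ n, loseSet n → subtree t (u ++ [k]) ∉ badMoves (⋃ n, winSet n)) := by
    intro u
    by_cases hu : subtree t u ∈ ⋃ n, loseSet n
    · exact ⟨0, id, fun h => absurd hu h⟩
    · obtain ⟨k, hk, hbad⟩ := exists_not_mem_badMoves hu
      rw [numChildren_subtree] at hk
      rw [← subtree_append] at hbad
      exact ⟨k, fun _ => hk, fun _ => hbad⟩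
  choose s hs using h
  exact ⟨s, fun u => (hs u).1, fun u => (hs u).2⟩

/-- Each move over an edge of weight 0 lowers the level by one, and at level 0 both sets are empty,
so the play has to end in favour of `q`. The two claims feed each other because the turn alternates.
-/
theorem exists_playWonIn_of_isAttack {t : WeightedTree} {σ : Bool → List ℕ → ℕ}
    (hσ : ∀ b, IsStrategy t (σ b)) {q : Bool} (hq : IsAttack t (σ q)) (n : ℕ) (u : List ℕ) :
    (subtree t u ∈ winSet n → ∃ m, PlayWonIn m q t σ (evenPosition u q)) ∧
      (subtree t u ∈ loseSet n → ∃ m, PlayWonIn m q t σ (evenPosition u (!q))) := by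
  induction n generalizing u with
  | zero => simp [winSet_zero, loseSet_zero]
  | succ n ih =>
    constructor
    · intro hu
      have hpos : 0 < numChildren t u := by
        obtain ⟨k, hk, -⟩ := mem_winSet_succ.1 hu
        rw [numChildren_subtree] at hk
        omega
      have hne := (not_hasWon_evenPosition (b := q)).2 hpos
      rcases hq u n hu with h1 | ⟨h0, hL⟩
      · rw [subtree_apply_nil] at h1
        exact ⟨1, playWonIn_succ.2 ⟨hne, playWonIn_zero.2 ((hasWon_move_of_pos h1).2 rfl)⟩⟩
      · rw [subtree_apply_nil] at h0
        obtain ⟨m, hm⟩ := (ih _).2 hL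
        exact ⟨m + 1, playWonIn_succ.2 ⟨hne, by rwa [move_evenPosition_of_zero h0]⟩⟩
    · intro hu
      rcases Nat.eq_zero_or_pos (numChildren t u) with hz | hpos
      · exact ⟨0, playWonIn_zero.2 (hasWon_evenPosition.2 ⟨by simp, hz⟩)⟩
      have hne := (not_hasWon_evenPosition (b := !q)).2 hpos
      have hk := hσ (!q) u hpos
      rw [← numChildren_subtree] at hk
      have hbad := mem_loseSet_succ.1 hu _ hk
      rw [← subtree_append] at hbad
      rcases hbad with h1 | ⟨h0, hW⟩
      · rw [subtree_apply_nil] at h1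
        exact ⟨1, playWonIn_succ.2 ⟨hne,
          playWonIn_zero.2 ((hasWon_move_of_neg h1).2 (by simp))⟩⟩
      · rw [subtree_apply_nil] at h0
        obtain ⟨m, hm⟩ := (ih _).1 hW
        refine ⟨m + 1, playWonIn_succ.2 ⟨hne, ?_⟩⟩
        rw [move_evenPosition_of_zero h0, Bool.not_not]
        exact hm

theorem not_playWonIn_of_hasWon {n : ℕ} {q : Bool} {t : WeightedTree} {σ : Bool → List ℕ → ℕ}
    {P : Position} (h : HasWon (!q) t P) (h' : ¬ HasWon q t P) : ¬ PlayWonIn n q t σ P := by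
  cases n with
  | zero => rwa [playWonIn_zero]
  | succ n => exact fun hw => (playWonIn_succ.1 hw).1 _ h

/-- The invariant is that the current tree is not decided in favour of `q`. The defender can
preserve it and `q` cannot break it, so by induction on its length no play is won by `q`. -/
theorem not_playWonIn_of_isDefence {t : WeightedTree} {σ : Bool → List ℕ → ℕ}
    (hσ : ∀ b, IsStrategy t (σ b)) {q : Bool} (hq : IsDefence t (σ (!q))) (n : ℕ) (u : List ℕ) :
    (subtree t u ∉ ⋃ n, winSet n → ¬ PlayWonIn n q t σ (evenPosition u q)) ∧
      (subtree t u ∉ ⋃ n, loseSet n → ¬ PlayWonIn n q t σ (evenPosition u (!q))) := by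
  induction n generalizing u with
  | zero =>
    simp only [playWonIn_zero, hasWon_evenPosition]
    -- A leaf lies in `loseSet 1` vacuously.
    refine ⟨by simp, fun hu h => hu (Set.mem_iUnion.2 ⟨1, mem_loseSet_succ.2 fun k hk => ?_⟩)⟩
    rw [numChildren_subtree, h.2] at hk
    omega
  | succ n ih =>
    constructor
    · intro hu hw
      obtain ⟨hne, hw⟩ := playWonIn_succ.1 hw
      have hk := hσ q u (not_hasWon_evenPosition.1 hne)
      rw [← numChildren_subtree] at hk
      have hgood := not_mem_goodMoves hu hk
      rw [← subtree_append] at hgood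
      rcases h : (t (u ++ [σ q u])).2 with _ | _ | _
      · rw [SignType.zero_eq_zero] at h
        rw [move_evenPosition_of_zero h] at hw
        refine (ih _).2 (fun hL => hgood (Or.inr ⟨?_, hL⟩)) hw
        rwa [subtree_apply_nil]
      · rw [SignType.neg_eq_neg_one] at h
        exact not_playWonIn_of_hasWon ((hasWon_move_of_neg h).2 rfl)
          (by simp [hasWon_move_of_neg h]) hw
      · rw [SignType.pos_eq_one] at h
        exact hgood (Or.inl (by rwa [subtree_apply_nil]))
    · intro hu hw
      obtain ⟨hne, hw⟩ := playWonIn_succ.1 hw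
      have hbad := hq u hu
      rcases h : (t (u ++ [σ (!q) u])).2 with _ | _ | _
      · rw [SignType.zero_eq_zero] at h
        rw [move_evenPosition_of_zero h, Bool.not_not] at hw
        refine (ih _).1 (fun hW => hbad (Or.inr ⟨?_, hW⟩)) hw
        rwa [subtree_apply_nil]
      · rw [SignType.neg_eq_neg_one] at h
        exact hbad (Or.inl (by rwa [subtree_apply_nil]))
      · rw [SignType.pos_eq_one] at h
        exact not_playWonIn_of_hasWon ((hasWon_move_of_pos h).2 rfl)
          (by simp [hasWon_move_of_pos h]) hw

theorem startPosition_one_one : startPosition [] 1 1 = evenPosition [] true := by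
  simp [startPosition, evenPosition]

theorem firstPlayerWins_iff {t : WeightedTree} :
    FirstPlayerWins 1 1 2 t [] ↔ t ∈ ⋃ n, winSet n := by
  rw [FirstPlayerWins, startPosition_one_one]
  constructor
  · rintro ⟨σ₁, h₁, hwin⟩
    by_contra ht
    obtain ⟨σ₂, h₂, hdef⟩ := exists_isStrategy_isDefence t
    obtain ⟨n, hn⟩ := (playWonBy₁_iff (σ := fun b => cond b σ₁ σ₂)).1 (hwin σ₂ h₂)
    exact (not_playWonIn_of_isDefence (by rintro (_ | _) <;> assumption) (q := true) hdef n []).1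
      ht hn
  · intro ht
    obtain ⟨n, hn⟩ := Set.mem_iUnion.1 ht
    obtain ⟨σ₁, h₁, hatt⟩ := exists_isStrategy_isAttack t
    exact ⟨σ₁, h₁, fun σ₂ h₂ => (playWonBy₁_iff (σ := fun b => cond b σ₁ σ₂)).2
      ((exists_playWonIn_of_isAttack (by rintro (_ | _) <;> assumption) (q := true)
        hatt n []).1 hn)⟩

theorem firstPlayerLoses_iff {t : WeightedTree} :
    FirstPlayerLoses 1 1 2 t [] ↔ t ∈ ⋃ n, loseSet n := by
  rw [FirstPlayerLoses, startPosition_one_one]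
  constructor
  · rintro ⟨σ₂, h₂, hwin⟩
    by_contra ht
    obtain ⟨σ₁, h₁, hdef⟩ := exists_isStrategy_isDefence t
    obtain ⟨n, hn⟩ := (playWonBy₂_iff (σ := fun b => cond b σ₁ σ₂)).1 (hwin σ₁ h₁)
    exact (not_playWonIn_of_isDefence (by rintro (_ | _) <;> assumption) (q := false) hdef n []).2
      ht hn
  · intro ht
    obtain ⟨n, hn⟩ := Set.mem_iUnion.1 ht
    obtain ⟨σ₂, h₂, hatt⟩ := exists_isStrategy_isAttack t
    exact ⟨σ₂, h₂, fun σ₁ h₁ => (playWonBy₂_iff (σ := fun b => cond b σ₁ σ₂)).2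
      ((exists_playWonIn_of_isAttack (by rintro (_ | _) <;> assumption) (q := false)
        hatt n []).2 hn)⟩

theorem isDraw_iff {t : WeightedTree} :
    IsDraw 1 1 2 t [] ↔ t ∉ (⋃ n, winSet n) ∪ ⋃ n, loseSet n := by
  rw [IsDraw, firstPlayerWins_iff, firstPlayerLoses_iff, Set.mem_union, not_or]

/-! ### The branching property -/

theorem edgeLaw_real_neg (p : EdgeProbabilities) : (edgeLaw p).real {-1} = p.neg := by
  have h1 : (1 : SignType) ≠ -1 := by decide
  simp [edgeLaw, measureReal_def, p.neg_nonneg, h1]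

theorem edgeLaw_real_zero (p : EdgeProbabilities) : (edgeLaw p).real {0} = p.zero := by
  simp [edgeLaw, measureReal_def, p.zero_nonneg]

theorem edgeLaw_real_pos (p : EdgeProbabilities) : (edgeLaw p).real {1} = p.pos := by
  have h1 : (-1 : SignType) ≠ 1 := by decide
  simp [edgeLaw, measureReal_def, p.pos_nonneg, h1]

/-- The tree with the data `a` at the root and the subtrees `f k`. -/
def graft (a : ℕ × SignType) (f : ℕ → WeightedTree) : WeightedTree
  | [] => a
  | k :: w => f k w

/-- The number of children of the root, together with the subtrees above the root. -/
def offspring (t : WeightedTree) : ℕ × (ℕ → WeightedTree) := ((t []).1, fun k => subtree t [k])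

theorem measurable_offspring : Measurable offspring := by
  unfold offspring subtree
  fun_prop

theorem measurable_graft :
    Measurable fun x : (ℕ × SignType) × (ℕ → WeightedTree) => graft x.1 x.2 := by
  refine measurable_pi_iff.2 fun w => ?_
  cases w with
  | nil => exact measurable_fst
  | cons k w =>
    change Measurable fun x : (ℕ × SignType) × (ℕ → WeightedTree) => x.2 k w
    fun_prop

variable {χ : Measure ℕ} [IsProbabilityMeasure χ] {p : EdgeProbabilities}

instance : IsProbabilityMeasure (galtonWatsonLaw χ p) := by
  unfold galtonWatsonLaw
  infer_instance

/-- A Galton–Watson tree arises from the data at its root and independent copies of itself. -/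
theorem map_graft_galtonWatsonLaw :
    ((χ.prod (edgeLaw p)).prod (Measure.infinitePi fun _ : ℕ => galtonWatsonLaw χ p)).map
      (fun x => graft x.1 x.2) = galtonWatsonLaw χ p := by
  classical
  refine Measure.eq_infinitePi _ fun s B hB => ?_
  have hinj : Set.InjOn (fun q : ℕ × List ℕ => q.1 :: q.2)
      ((fun q : ℕ × List ℕ => q.1 :: q.2) ⁻¹' (s : Set (List ℕ))) := by
    rintro ⟨k, w⟩ - ⟨k', w'⟩ - h
    simpa using h
  set s' : Finset (ℕ × List ℕ) := s.preimage _ hinj with hs'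
  -- Boxes over finitely many words determine the product measure. Such a box splits into a
  -- condition at the root, void if `[] ∉ s`, and a box over the words `k :: w`, indexed by pairs
  -- `(k, w)`.
  have hpre : (fun x : (ℕ × SignType) × (ℕ → WeightedTree) => graft x.1 x.2) ⁻¹'
        (s : Set (List ℕ)).pi B = {a | [] ∈ s → a ∈ B []} ×ˢ
          ((MeasurableEquiv.curry ℕ (List ℕ) (ℕ × SignType)).symm ⁻¹'
            (s' : Set (ℕ × List ℕ)).pi fun q => B (q.1 :: q.2)) := by
    ext ⟨a, f⟩
    simp only [Set.mem_preimage, Set.mem_pi, Finset.mem_coe, Set.mem_prod, Set.mem_ofPred_eq, hs',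
      Finset.mem_preimage, Prod.forall]
    constructor
    · intro h
      exact ⟨h [], fun k w hkw => h _ hkw⟩
    · rintro ⟨h0, h1⟩ (_ | ⟨k, w⟩) hw
      · exact h0 hw
      · exact h1 k w hw
  have hpi : MeasurableSet ((s' : Set (ℕ × List ℕ)).pi fun q => B (q.1 :: q.2)) :=
    .pi s'.countable_toSet fun _ _ => hB _
  rw [Measure.map_apply measurable_graft (.pi s.countable_toSet fun _ _ => hB _), hpre,
    Measure.prod_prod, ← Measure.map_apply (by fun_prop) hpi]
  unfold galtonWatsonLaw
  rw [Measure.infinitePi_map_curry_symm (fun (_ : ℕ) (_ : List ℕ) => χ.prod (edgeLaw p)),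
    Measure.infinitePi_pi _ fun _ _ => hB _]
  have herase : ∏ q ∈ s', (χ.prod (edgeLaw p)) (B (q.1 :: q.2)) =
      ∏ w ∈ s.erase [], (χ.prod (edgeLaw p)) (B w) := by
    refine Finset.prod_bij (fun q _ => q.1 :: q.2) ?_ ?_ ?_ ?_
    · intro q hq
      simpa [hs'] using hq
    · rintro ⟨k, w⟩ - ⟨k', w'⟩ - h
      simpa using h
    · rintro (_ | ⟨k, w⟩) hw
      · simp at hw
      · exact ⟨(k, w), by simpa [hs'] using hw, rfl⟩
    · intro q _
      rfl
  rw [herase]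
  by_cases h : [] ∈ s
  · simp [h, Finset.mul_prod_erase s (fun w => (χ.prod (edgeLaw p)) (B w)) h]
  · simp [h]

/-- Under the law of the Galton–Watson tree, the number of children of the root, the subtrees above
the root, and the weight recorded at the root are independent. -/
theorem map_offspring_weight :
    (galtonWatsonLaw χ p).map (fun t => ((t []).2, offspring t)) =
      (edgeLaw p).prod (χ.prod (Measure.infinitePi fun _ : ℕ => galtonWatsonLaw χ p)) := by
  have hm : Measurable fun t : WeightedTree => ((t []).2, offspring t) :=
    (by fun_prop : Measurable fun t : WeightedTree => (t []).2).prodMk measurable_offspring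
  conv_lhs => rw [← map_graft_galtonWatsonLaw]
  rw [Measure.map_map hm measurable_graft]
  have : ((fun t : WeightedTree => ((t []).2, offspring t)) ∘
      fun x : (ℕ × SignType) × (ℕ → WeightedTree) => graft x.1 x.2) =
      fun x => (x.1.2, (x.1.1, x.2)) := rfl
  rw [this]
  symm
  have h1 : (fun x : (ℕ × SignType) × (ℕ → WeightedTree) => (x.1.2, (x.1.1, x.2))) =
      MeasurableEquiv.prodAssoc ∘ Prod.map Prod.swap id := rfl
  rw [h1, ← Measure.map_map (by fun_prop) (by fun_prop),
    ← Measure.map_prod_map _ _ (by fun_prop) (by fun_prop), Measure.map_id, Measure.prod_swap,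
    Measure.prodAssoc_prod]

theorem map_offspring :
    (galtonWatsonLaw χ p).map offspring =
      χ.prod (Measure.infinitePi fun _ : ℕ => galtonWatsonLaw χ p) := by
  have hm : Measurable fun t : WeightedTree => ((t []).2, offspring t) :=
    (by fun_prop : Measurable fun t : WeightedTree => (t []).2).prodMk measurable_offspring
  have h : offspring = Prod.snd ∘ fun t : WeightedTree => ((t []).2, offspring t) := rfl
  rw [h, ← Measure.map_map measurable_snd hm, map_offspring_weight, Measure.map_snd_prod]
  simp

/-- The configurations of children all of whose subtrees belong to `A`. -/
def allChildren (A : Set WeightedTree) : Set (ℕ × (ℕ → WeightedTree)) :=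
  {x | ∀ k < x.1, x.2 k ∈ A}

theorem measurableSet_allChildren {A : Set WeightedTree} (hA : MeasurableSet A) :
    MeasurableSet (allChildren A) := by
  have : allChildren A = ⋂ k : ℕ, {x | x.1 ≤ k} ∪ {x | x.2 k ∈ A} := by
    ext x
    simp only [allChildren, Set.mem_ofPred_eq, Set.mem_iInter, Set.mem_union]
    exact forall_congr' fun k => by rw [← not_lt, ← imp_iff_not_or]
  rw [this]
  refine .iInter fun k => .union (measurable_fst (MeasurableSet.of_discrete (s := {n | n ≤ k}))) ?_
  exact (by fun_prop : Measurable fun x : ℕ × (ℕ → WeightedTree) => x.2 k) hA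

/-- The generating function of the offspring distribution. -/
noncomputable def generatingFunction (χ : Measure ℕ) (s : ℝ) : ℝ := ∫ k, s ^ k ∂χ

/-- Given `n` children, their subtrees are independent copies of the tree and all lie in `A` with
probability the `n`-th power of that of `A`; then average over `n`. -/
theorem measureReal_offspring_preimage {A : Set WeightedTree} (hA : MeasurableSet A) :
    (galtonWatsonLaw χ p).real (offspring ⁻¹' allChildren A) =
      generatingFunction χ ((galtonWatsonLaw χ p).real A) := by
  rw [← map_measureReal_apply measurable_offspring (measurableSet_allChildren hA), map_offspring,
    measureReal_def, Measure.prod_apply (measurableSet_allChildren hA), generatingFunction,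
    integral_eq_lintegral_of_nonneg_ae (.of_forall fun k => by positivity) (by fun_prop)]
  congr 1
  refine lintegral_congr fun n => ?_
  have : Prod.mk n ⁻¹' allChildren A = (Finset.range n : Set ℕ).pi fun _ => A := by
    ext f
    simp [allChildren]
  rw [this, Measure.infinitePi_pi _ fun _ _ => hA, Finset.prod_const, Finset.card_range,
    measureReal_def, ← ENNReal.toReal_pow, ENNReal.ofReal_toReal]
  exact ENNReal.pow_ne_top (measure_ne_top _ _)

theorem measureReal_weight_inter_offspring (c : SignType) {D : Set (ℕ × (ℕ → WeightedTree))}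
    (hD : MeasurableSet D) :
    (galtonWatsonLaw χ p).real {s | (s []).2 = c ∧ s ∈ offspring ⁻¹' D} =
      (edgeLaw p).real {c} * (galtonWatsonLaw χ p).real (offspring ⁻¹' D) := by
  have hm : Measurable fun t : WeightedTree => ((t []).2, offspring t) :=
    (by fun_prop : Measurable fun t : WeightedTree => (t []).2).prodMk measurable_offspring
  have : {s : WeightedTree | (s []).2 = c ∧ s ∈ offspring ⁻¹' D} =
      (fun t : WeightedTree => ((t []).2, offspring t)) ⁻¹' ({c} ×ˢ D) := by
    ext s
    simp
  rw [this, ← map_measureReal_apply hm (.prod (.singleton c) hD), map_offspring_weight,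
    measureReal_prod_prod, ← map_measureReal_apply measurable_offspring hD, map_offspring]

theorem measureReal_weight (c : SignType) :
    (galtonWatsonLaw χ p).real {s | (s []).2 = c} = (edgeLaw p).real {c} := by
  have := measureReal_weight_inter_offspring (χ := χ) (p := p) c .univ
  simpa using this

theorem measurableSet_weight (c : SignType) :
    MeasurableSet {s : WeightedTree | (s []).2 = c} :=
  (by fun_prop : Measurable fun t : WeightedTree => (t []).2) (.singleton c)

theorem measurableSet_weight_or {c : SignType} {L : Set WeightedTree} (hL : MeasurableSet L) :
    MeasurableSet {s : WeightedTree | (s []).2 = c ∨ ((s []).2 = 0 ∧ s ∈ L)} :=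
  (measurableSet_weight c).union ((measurableSet_weight 0).inter hL)

theorem measureReal_weight_or {c : SignType} (hc : c ≠ 0) {D : Set (ℕ × (ℕ → WeightedTree))}
    (hD : MeasurableSet D) :
    (galtonWatsonLaw χ p).real {s | (s []).2 = c ∨ ((s []).2 = 0 ∧ s ∈ offspring ⁻¹' D)} =
      (edgeLaw p).real {c} + p.zero * (galtonWatsonLaw χ p).real (offspring ⁻¹' D) := by
  have hm : MeasurableSet {s : WeightedTree | (s []).2 = 0 ∧ s ∈ offspring ⁻¹' D} :=
    (measurableSet_weight 0).inter (measurable_offspring hD)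
  rw [Set.ofPred_or, measureReal_union _ hm, measureReal_weight,
    measureReal_weight_inter_offspring 0 hD, edgeLaw_real_zero]
  rw [Set.disjoint_left]
  rintro s h1 ⟨h2, -⟩
  exact hc (h1.symm.trans h2)

/-! ### The probabilities of a decision within a given number of moves -/

theorem loseSet_succ_eq (n : ℕ) :
    loseSet (n + 1) = offspring ⁻¹' allChildren (badMoves (winSet n)) := by
  ext t
  rw [mem_loseSet_succ]
  rfl

theorem winSet_succ_eq (n : ℕ) :
    winSet (n + 1) = offspring ⁻¹' (allChildren (goodMoves (loseSet n))ᶜ)ᶜ := by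
  ext t
  rw [mem_winSet_succ, Set.preimage_compl, Set.mem_compl_iff]
  change _ ↔ ¬ ∀ k < numChildren t [], subtree t [k] ∈ (goodMoves (loseSet n))ᶜ
  simp

/-- The outcome does not depend on the weight recorded at the root. This makes the edge to a child
independent of the outcome on the child's subtree. -/
theorem exists_winSet_loseSet_eq (n : ℕ) :
    (∃ D, MeasurableSet D ∧ winSet n = offspring ⁻¹' D) ∧
      ∃ D, MeasurableSet D ∧ loseSet n = offspring ⁻¹' D := by
  induction n with
  | zero => exact ⟨⟨∅, .empty, by simp [winSet_zero]⟩, ⟨∅, .empty, by simp [loseSet_zero]⟩⟩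
  | succ n ih =>
    obtain ⟨⟨D, hD, hW⟩, ⟨E, hE, hL⟩⟩ := ih
    refine ⟨⟨_, ?_, winSet_succ_eq n⟩, ⟨_, ?_, loseSet_succ_eq n⟩⟩
    · refine (measurableSet_allChildren (measurableSet_weight_or ?_).compl).compl
      exact hL ▸ measurable_offspring hE
    · refine measurableSet_allChildren (measurableSet_weight_or ?_)
      exact hW ▸ measurable_offspring hD

theorem measurableSet_winSet (n : ℕ) : MeasurableSet (winSet n) := by
  obtain ⟨D, hD, h⟩ := (exists_winSet_loseSet_eq n).1
  exact h ▸ measurable_offspring hD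

theorem measurableSet_loseSet (n : ℕ) : MeasurableSet (loseSet n) := by
  obtain ⟨D, hD, h⟩ := (exists_winSet_loseSet_eq n).2
  exact h ▸ measurable_offspring hD

variable (χ p)

/-- All moves must be bad, and each one is bad with probability p₋₁ + p₀ w_n. -/
theorem measureReal_loseSet_succ (n : ℕ) :
    (galtonWatsonLaw χ p).real (loseSet (n + 1)) =
      generatingFunction χ (p.neg + p.zero * (galtonWatsonLaw χ p).real (winSet n)) := by
  obtain ⟨D, hD, h⟩ := (exists_winSet_loseSet_eq n).1
  have hbad : MeasurableSet (badMoves (winSet n)) :=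
    measurableSet_weight_or (measurableSet_winSet n)
  rw [loseSet_succ_eq, measureReal_offspring_preimage hbad, h, badMoves,
    measureReal_weight_or (by decide) hD, edgeLaw_real_neg]

/-- The complementary event is that no move is good; a single move fails to be good with probability
1 - p₁ - p₀ l_n = p₋₁ + p₀ (1 - l_n). -/
theorem measureReal_winSet_succ (n : ℕ) :
    (galtonWatsonLaw χ p).real (winSet (n + 1)) =
      1 - generatingFunction χ
        (p.neg + p.zero * (1 - (galtonWatsonLaw χ p).real (loseSet n))) := by
  obtain ⟨D, hD, h⟩ := (exists_winSet_loseSet_eq n).2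
  have hgood : MeasurableSet (goodMoves (loseSet n)) :=
    measurableSet_weight_or (measurableSet_loseSet n)
  rw [winSet_succ_eq, Set.preimage_compl, probReal_compl_eq_one_sub
    (measurable_offspring (measurableSet_allChildren hgood.compl)),
    measureReal_offspring_preimage hgood.compl, probReal_compl_eq_one_sub hgood, h, goodMoves,
    measureReal_weight_or (by decide) hD, edgeLaw_real_pos]
  congr 2
  linear_combination -p.sum_eq_one

/-! ### The draw probability and the cycles of length two -/

variable {χ}

theorem integrable_pow {s : ℝ} (h0 : 0 ≤ s) (h1 : s ≤ 1) : Integrable (fun k : ℕ => s ^ k) χ :=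
  .of_bound (by fun_prop) 1 (.of_forall fun k => by
    rw [Real.norm_of_nonneg (by positivity)]
    exact pow_le_one₀ h0 h1)

theorem generatingFunction_mono {s s' : ℝ} (h0 : 0 ≤ s) (h : s ≤ s') (h1 : s' ≤ 1) :
    generatingFunction χ s ≤ generatingFunction χ s' :=
  integral_mono (integrable_pow h0 (h.trans h1)) (integrable_pow (h0.trans h) h1)
    fun k => pow_le_pow_left₀ h0 h k

theorem continuousOn_generatingFunction :
    ContinuousOn (generatingFunction χ) (Set.Icc 0 1) := by
  refine continuousOn_of_dominated (bound := fun _ => 1) (fun s _ => by fun_prop) ?_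
    (integrable_const 1) (.of_forall fun k => by fun_prop)
  refine fun s hs => .of_forall fun k => ?_
  rw [Real.norm_of_nonneg (pow_nonneg hs.1 k)]
  exact pow_le_one₀ hs.1 hs.2

variable {p}

theorem neg_add_zero_mul_mem_Icc {x : ℝ} (hx : x ∈ Set.Icc (0 : ℝ) 1) :
    p.neg + p.zero * x ∈ Set.Icc (0 : ℝ) 1 := by
  have := p.neg_nonneg
  have h0 := p.zero_nonneg
  have := p.pos_nonneg
  have := p.sum_eq_one
  have := mul_nonneg h0 hx.1
  have := mul_le_mul_of_nonneg_left hx.2 h0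
  constructor <;> linarith

theorem generatingFunction_neg_add_mono {x y : ℝ} (hx : x ∈ Set.Icc (0 : ℝ) 1)
    (hy : y ∈ Set.Icc (0 : ℝ) 1) (h : x ≤ y) :
    generatingFunction χ (p.neg + p.zero * x) ≤ generatingFunction χ (p.neg + p.zero * y) :=
  generatingFunction_mono (neg_add_zero_mul_mem_Icc hx).1
    (by linarith [mul_le_mul_of_nonneg_left h p.zero_nonneg]) (neg_add_zero_mul_mem_Icc hy).2

theorem tendsto_generatingFunction {f : ℕ → ℝ} {x : ℝ} (hf : ∀ n, f n ∈ Set.Icc (0 : ℝ) 1)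
    (h : Filter.Tendsto f .atTop (nhds x)) :
    Filter.Tendsto (fun n => generatingFunction χ (p.neg + p.zero * f n)) .atTop
      (nhds (generatingFunction χ (p.neg + p.zero * x))) := by
  have hx : x ∈ Set.Icc (0 : ℝ) 1 := isClosed_Icc.mem_of_tendsto h (.of_forall hf)
  refine (continuousOn_generatingFunction _ (neg_add_zero_mul_mem_Icc hx)).tendsto.comp ?_
  exact tendsto_nhdsWithin_iff.2 ⟨(h.const_mul _).const_add _,
    .of_forall fun n => neg_add_zero_mul_mem_Icc (hf n)⟩

theorem measureReal_mem_Icc (A : Set WeightedTree) :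
    (galtonWatsonLaw χ p).real A ∈ Set.Icc (0 : ℝ) 1 :=
  ⟨measureReal_nonneg, measureReal_le_one⟩

theorem one_sub_mem_Icc {x : ℝ} (hx : x ∈ Set.Icc (0 : ℝ) 1) : 1 - x ∈ Set.Icc (0 : ℝ) 1 :=
  ⟨by linarith [hx.2], by linarith [hx.1]⟩

theorem tendsto_measureReal_iUnion {A : ℕ → Set WeightedTree} (hA : Monotone A) :
    Filter.Tendsto (fun n => (galtonWatsonLaw χ p).real (A n)) .atTop
      (nhds ((galtonWatsonLaw χ p).real (⋃ n, A n))) :=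
  (ENNReal.tendsto_toReal (measure_ne_top _ _)).comp (tendsto_measure_iUnion_atTop hA)

theorem drawProbability_eq :
    drawProbability χ p 2 1 1 = 1 - ((galtonWatsonLaw χ p).real (⋃ n, winSet n) +
      (galtonWatsonLaw χ p).real (⋃ n, loseSet n)) := by
  have hset : {t | IsDraw 1 1 2 t []} = ((⋃ n, winSet n) ∪ ⋃ n, loseSet n)ᶜ := by
    ext t
    exact isDraw_iff
  have hW : MeasurableSet (⋃ n, winSet n) := .iUnion measurableSet_winSet
  have hL : MeasurableSet (⋃ n, loseSet n) := .iUnion measurableSet_loseSet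
  rw [drawProbability, hset, probReal_compl_eq_one_sub (hW.union hL), measureReal_union _ hL]
  simp only [Set.disjoint_iUnion_left, Set.disjoint_iUnion_right]
  exact fun n m => disjoint_winSet_loseSet m n

/-- Draws have probability `0` if and only if the map `x ↦ 1 - G (p₋₁ + p₀ x)` of the unit interval,
where `G` is the generating function of the offspring distribution, has no cycle of length two. -/
theorem drawProbability_eq_zero_iff :
    drawProbability χ p 2 1 1 = 0 ↔ ∀ x ∈ Set.Icc (0 : ℝ) 1, ∀ y ∈ Set.Icc (0 : ℝ) 1,
      x = 1 - generatingFunction χ (p.neg + p.zero * y) →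
      y = 1 - generatingFunction χ (p.neg + p.zero * x) → x = y := by
  have hwlim := tendsto_measureReal_iUnion (χ := χ) (p := p) monotone_winSet
  have hllim := tendsto_measureReal_iUnion (χ := χ) (p := p) monotone_loseSet
  rw [drawProbability_eq]
  constructor
  · intro h x hx y hy hxy hyx
    -- The antitone map exchanges the lower and upper bounds and the two points of the cycle, so the
    -- sandwich persists. In the limit w + l = 1 forces the two points together.
    have hbound : ∀ n, ((galtonWatsonLaw χ p).real (winSet n) ≤ x ∧
        (galtonWatsonLaw χ p).real (winSet n) ≤ y) ∧
        (x ≤ 1 - (galtonWatsonLaw χ p).real (loseSet n) ∧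
        y ≤ 1 - (galtonWatsonLaw χ p).real (loseSet n)) := by
      intro n
      induction n with
      | zero => simp [winSet_zero, loseSet_zero, hx.1, hy.1, hx.2, hy.2]
      | succ n ih =>
        have hwn := measureReal_mem_Icc (χ := χ) (p := p) (winSet n)
        have hln := one_sub_mem_Icc (measureReal_mem_Icc (χ := χ) (p := p) (loseSet n))
        rw [measureReal_winSet_succ, measureReal_loseSet_succ]
        have h1 := generatingFunction_neg_add_mono (χ := χ) (p := p) hwn hx ih.1.1
        have h2 := generatingFunction_neg_add_mono (χ := χ) (p := p) hwn hy ih.1.2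
        have h3 := generatingFunction_neg_add_mono (χ := χ) (p := p) hx hln ih.2.1
        have h4 := generatingFunction_neg_add_mono (χ := χ) (p := p) hy hln ih.2.2
        refine ⟨⟨?_, ?_⟩, ?_, ?_⟩ <;> linarith
    have h1 := le_of_tendsto' hwlim fun n => (hbound n).1.1
    have h2 := le_of_tendsto' hwlim fun n => (hbound n).1.2
    have h3 := ge_of_tendsto' (hllim.const_sub 1) fun n => (hbound n).2.1
    have h4 := ge_of_tendsto' (hllim.const_sub 1) fun n => (hbound n).2.2
    linarith
  · intro h
    have hw := measureReal_mem_Icc (χ := χ) (p := p) (⋃ n, winSet n)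
    have hl := one_sub_mem_Icc (measureReal_mem_Icc (χ := χ) (p := p) (⋃ n, loseSet n))
    have h1 := tendsto_generatingFunction (χ := χ) (p := p)
      (fun n => measureReal_mem_Icc (winSet n)) hwlim
    have h2 := tendsto_generatingFunction (χ := χ) (p := p)
      (fun n => one_sub_mem_Icc (measureReal_mem_Icc (loseSet n))) (hllim.const_sub 1)
    simp only [← measureReal_loseSet_succ] at h1
    have h2' := h2.const_sub 1
    simp only [← measureReal_winSet_succ] at h2'
    have e1 := tendsto_nhds_unique (hllim.comp (Filter.tendsto_add_atTop_nat 1)) h1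
    have e2 := tendsto_nhds_unique (hwlim.comp (Filter.tendsto_add_atTop_nat 1)) h2'
    -- The limits w and 1 - l themselves form a 2-cycle.
    have := h _ hw _ hl e2 (by rw [e1])
    linarith

/-! ### Complete homogeneous polynomials in two variables -/

/-- The complete homogeneous polynomial `∑ i + j = k, v ^ i * w ^ j`. -/
def homogeneousSum (v w : ℝ) : ℕ → ℝ
  | 0 => 1
  | k + 1 => v * homogeneousSum v w k + w ^ (k + 1)

theorem homogeneousSum_zero (v w : ℝ) : homogeneousSum v w 0 = 1 := rfl

theorem homogeneousSum_succ (v w : ℝ) (k : ℕ) :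
    homogeneousSum v w (k + 1) = v * homogeneousSum v w k + w ^ (k + 1) := rfl

theorem homogeneousSum_succ' (v w : ℝ) (k : ℕ) :
    homogeneousSum v w (k + 1) = w * homogeneousSum v w k + v ^ (k + 1) := by
  induction k with
  | zero =>
    rw [homogeneousSum_succ, homogeneousSum_zero]
    ring
  | succ k ih =>
    rw [homogeneousSum_succ]
    linear_combination v * ih - w * homogeneousSum_succ v w k

theorem sub_mul_homogeneousSum (v w : ℝ) (k : ℕ) :
    (v - w) * homogeneousSum v w k = v ^ (k + 1) - w ^ (k + 1) := by
  linear_combination homogeneousSum_succ' v w k - homogeneousSum_succ v w k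

theorem homogeneousSum_add_two (v w : ℝ) (k : ℕ) :
    homogeneousSum v w (k + 2) = v ^ (k + 2) + w ^ (k + 2) + v * w * homogeneousSum v w k := by
  rw [homogeneousSum_succ, homogeneousSum_succ']
  ring

/-- The two one-step recursions express v^(k+1) and w^(k+1) through consecutive sums; multiplying
them gives this Cassini-type identity. -/
theorem homogeneousSum_sq_sub (v w : ℝ) (k : ℕ) :
    homogeneousSum v w (k + 1) ^ 2 - homogeneousSum v w k * homogeneousSum v w (k + 2) =
      (v * w) ^ (k + 1) := by
  have h1 := homogeneousSum_succ v w k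
  have h2 := homogeneousSum_succ' v w k
  have h3 := homogeneousSum_succ v w (k + 1)
  rw [h3, mul_pow]
  have e1 : w ^ (k + 1) = homogeneousSum v w (k + 1) - v * homogeneousSum v w k := by linarith
  have e2 : v ^ (k + 1) = homogeneousSum v w (k + 1) - w * homogeneousSum v w k := by linarith
  rw [pow_succ w (k + 1), e1, e2]
  ring

theorem homogeneousSum_pos {v w : ℝ} (hv : 0 ≤ v) (hw : 0 ≤ w) (h : 0 < v + w) (k : ℕ) :
    0 < homogeneousSum v w k := by
  induction k with
  | zero => simp [homogeneousSum_zero]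
  | succ k ih =>
    rcases hv.eq_or_lt with rfl | hv
    · rw [homogeneousSum_succ]
      have : 0 < w := by linarith
      positivity
    · rw [homogeneousSum_succ]
      positivity

theorem homogeneousSum_one_one (k : ℕ) : homogeneousSum 1 1 k = k + 1 := by
  induction k with
  | zero => simp [homogeneousSum_zero]
  | succ k ih => simp [homogeneousSum_succ, ih]

theorem homogeneousSum_one_zero (k : ℕ) : homogeneousSum 1 0 k = 1 := by
  induction k with
  | zero => rfl
  | succ k ih => simp [homogeneousSum_succ, ih]

theorem continuous_homogeneousSum (v : ℝ) (k : ℕ) :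
    Continuous fun w => homogeneousSum v w k := by
  induction k with
  | zero => exact continuous_const
  | succ k ih =>
    simp only [homogeneousSum_succ]
    fun_prop

theorem two_mul_pow_lt_sq_pow_add {α β : ℝ} (hα : 0 ≤ α) (hβ : 0 ≤ β) (h : α ≠ β) (k : ℕ) :
    2 * (α * β) ^ (k + 1) < (α ^ 2) ^ (k + 1) + (β ^ 2) ^ (k + 1) := by
  have hne : α ^ (k + 1) - β ^ (k + 1) ≠ 0 := fun h' =>
    h ((pow_left_inj₀ hα hβ (by omega)).1 (sub_eq_zero.1 h'))
  have := sq_pos_of_ne_zero hne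
  rw [mul_pow, pow_right_comm α, pow_right_comm β]
  linarith

/-- The arithmetic–geometric inequality for the monomials: the two extreme ones are paired, which
gives strictness, and the rest is the sum of degree two less times α²β². Squares as arguments avoid
half-integer powers in the geometric mean. -/
theorem mul_pow_lt_homogeneousSum_sq {α β : ℝ} (hα : 0 ≤ α) (hβ : 0 ≤ β) (h : α ≠ β) :
    ∀ k : ℕ, ((k + 1 : ℕ) + 1) * (α * β) ^ (k + 1) < homogeneousSum (α ^ 2) (β ^ 2) (k + 1)
  | 0 => by
    have := two_mul_pow_lt_sq_pow_add hα hβ h 0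
    simp only [homogeneousSum_succ, homogeneousSum_zero]
    norm_num at this ⊢
    linarith
  | 1 => by
    have := two_mul_pow_lt_sq_pow_add hα hβ h 1
    rw [homogeneousSum_add_two, homogeneousSum_zero]
    norm_num [mul_pow] at this ⊢
    linarith
  | k + 2 => by
    have h1 := two_mul_pow_lt_sq_pow_add hα hβ h (k + 2)
    have h2 := mul_le_mul_of_nonneg_left (mul_pow_lt_homogeneousSum_sq hα hβ h k).le
      (sq_nonneg (α * β))
    have h3 : (α * β) ^ (k + 2 + 1) = (α * β) ^ 2 * (α * β) ^ (k + 1) := by ring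
    have h4 : α ^ 2 * β ^ 2 = (α * β) ^ 2 := by ring
    rw [show k + 2 + 1 = k + 1 + 2 by ring, homogeneousSum_add_two, h4]
    rw [show k + 2 + 1 = k + 1 + 2 by ring] at h1 h3
    rw [h3] at h1 ⊢
    push_cast at h2 ⊢
    linarith

theorem sq_mul_pow_lt_homogeneousSum_sq {v w : ℝ} (hv : 0 ≤ v) (hw : 0 ≤ w) (h : v ≠ w) (k : ℕ) :
    ((k : ℝ) + 2) ^ 2 * (v * w) ^ (k + 1) < homogeneousSum v w (k + 1) ^ 2 := by
  have hne : √v ≠ √w := fun h' => h ((Real.sqrt_inj hv hw).1 h')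
  have := mul_pow_lt_homogeneousSum_sq (Real.sqrt_nonneg v) (Real.sqrt_nonneg w) hne k
  rw [Real.sq_sqrt hv, Real.sq_sqrt hw] at this
  have h2 := pow_lt_pow_left₀ this (by positivity) two_ne_zero
  rw [mul_pow, ← pow_mul, mul_comm (k + 1) 2, pow_mul, mul_pow (√v), Real.sq_sqrt hv,
    Real.sq_sqrt hw] at h2
  push_cast at h2
  rwa [add_assoc, one_add_one_eq_two] at h2

/-- The average of the monomials in `homogeneousSum`. -/
noncomputable def homogeneousMean (v w : ℝ) (k : ℕ) : ℝ := homogeneousSum v w k / (k + 1)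

theorem homogeneousMean_pos {v w : ℝ} (hv : 0 ≤ v) (hw : 0 ≤ w) (h : 0 < v + w) (k : ℕ) :
    0 < homogeneousMean v w k :=
  div_pos (homogeneousSum_pos hv hw h k) (by positivity)

theorem homogeneousMean_zero (v w : ℝ) : homogeneousMean v w 0 = 1 := by
  simp [homogeneousMean, homogeneousSum_zero]

/-- These means are the moments of the uniform law on the interval between `v` and `w`, so
Cauchy–Schwarz is behind this. Algebraically, since (k+1)(k+3) = (k+2)² - 1, the Cassini identity
reduces the claim to the arithmetic–geometric bound. -/
theorem homogeneousMean_sq_lt {v w : ℝ} (hv : 0 ≤ v) (hw : 0 ≤ w) (h : v ≠ w) (k : ℕ) :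
    homogeneousMean v w (k + 1) ^ 2 < homogeneousMean v w k * homogeneousMean v w (k + 2) := by
  have h1 := homogeneousSum_sq_sub v w k
  have h2 := sq_mul_pow_lt_homogeneousSum_sq hv hw h k
  simp only [homogeneousMean]
  rw [div_pow, div_mul_div_comm, div_lt_div_iff₀ (by positivity) (by positivity)]
  push_cast
  rw [← h1] at h2
  nlinarith

-- Power inequalities for strictly log-convex sequences.

section LogConvex

variable {m : ℕ → ℝ} (hm : ∀ k, 0 < m k) (hlog : ∀ k, m (k + 1) ^ 2 < m k * m (k + 2))
include hm hlog

/-- This is the growth of the roots m_k^(1/k): raise log-convexity to the power k + 2, insert the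
previous case and cancel. -/
theorem pow_lt_pow_of_log_convex (h0 : m 0 = 1) (k : ℕ) :
    m (k + 1) ^ (k + 2) < m (k + 2) ^ (k + 1) := by
  induction k with
  | zero => simpa [h0] using hlog 0
  | succ k ih =>
    have h1 := pow_lt_pow_left₀ (hlog (k + 1)) (by positivity) (n := k + 2) (by omega)
    rw [mul_pow] at h1
    have h2 := mul_lt_mul_of_pos_right ih (pow_pos (hm (k + 3)) (k + 2))
    have h3 := h1.trans h2
    refine lt_of_mul_lt_mul_left (a := m (k + 2) ^ (k + 1)) ?_ (pow_pos (hm _) _).le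
    refine lt_of_eq_of_lt ?_ h3
    ring

/-- If m_k has degree k and `q` degree 2, both sides have degree (k+1)(k+2), as needed for a bound
on 2-cycles with q = s t that depends only on s / t. -/
theorem mul_pow_lt_pow_of_log_convex (h0 : m 0 = 1) {q : ℝ} (hq : 0 < q) (hq1 : q < m 1 ^ 2)
    (k : ℕ) : q * m k ^ (k + 3) < m (k + 1) ^ (k + 2) := by
  induction k with
  | zero => simpa [h0] using hq1
  | succ k ih =>
    have h1 := pow_lt_pow_left₀ (hlog k) (by positivity) (n := k + 3) (by omega)
    rw [mul_pow] at h1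
    have h2 := mul_lt_mul_of_pos_right ih (pow_pos (hm (k + 2)) (k + 3))
    have h3 := mul_lt_mul_of_pos_left h1 hq
    refine lt_of_mul_lt_mul_left (a := m (k + 1) ^ (k + 2)) ?_ (pow_pos (hm _) _).le
    calc m (k + 1) ^ (k + 2) * (q * m (k + 1) ^ (k + 1 + 3))
        = q * (m (k + 1) ^ 2) ^ (k + 3) := by ring
      _ < q * (m k ^ (k + 3) * m (k + 2) ^ (k + 3)) := h3
      _ = q * m k ^ (k + 3) * m (k + 2) ^ (k + 3) := by ring
      _ < _ := h2

end LogConvex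

/-! ### Cycles of length two -/

/-- With d = k + 2, distinct points give b h_{d-1} = 1 and a h_{d-1} = h_d, so log-convexity puts b
a^{d-1} = h_d^{d-1} / h_{d-1}^d strictly above the threshold. -/
theorem eq_of_two_cycle_sub_mul_pow {a b v w : ℝ} {k : ℕ} (hv : 0 ≤ v) (hw : 0 ≤ w)
    (hvw : v = a - b * w ^ (k + 2)) (hwv : w = a - b * v ^ (k + 2))
    (hab : b * a ^ (k + 1) ≤ ((k : ℝ) + 3) ^ (k + 1) / ((k : ℝ) + 2) ^ (k + 2)) : v = w := by
  by_contra hne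
  have hpos : 0 < v + w := by
    rcases hv.eq_or_lt with rfl | hv
    · have := hw.lt_of_ne hne
      linarith
    · linarith
  set h := homogeneousSum v w (k + 1) with hh
  set h' := homogeneousSum v w (k + 2) with hh'
  have hp : 0 < h := homogeneousSum_pos hv hw hpos _
  have hbh : b * h = 1 := by
    have := sub_mul_homogeneousSum v w (k + 1)
    refine mul_left_cancel₀ (sub_ne_zero.2 hne) ?_
    linear_combination b * this - hvw + hwv
  have hah : a * h = h' := by
    have := homogeneousSum_succ v w (k + 1)
    linear_combination -this - h * hvw + w ^ (k + 2) * hbh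
  have key := pow_lt_pow_of_log_convex (homogeneousMean_pos hv hw hpos)
    (homogeneousMean_sq_lt hv hw hne) (homogeneousMean_zero v w) k
  simp only [homogeneousMean, ← hh, ← hh', div_pow] at key
  push_cast at key
  have e : b * a ^ (k + 1) * h ^ (k + 2) = h' ^ (k + 1) := by
    rw [← hah, mul_pow]
    linear_combination a ^ (k + 1) * h ^ (k + 1) * hbh
  rw [← e, div_lt_div_iff₀ (by positivity) (by positivity)] at key
  rw [le_div_iff₀ (by positivity)] at hab
  have := mul_le_mul_of_nonneg_right hab (pow_pos hp (k + 2)).le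
  ring_nf at this key
  linarith

theorem exists_two_cycle_sub_mul_pow {a b : ℝ} {k : ℕ} (hb : 0 ≤ b) (hba : b ≤ a) (ha : a ≤ 1)
    (hab : ((k : ℝ) + 3) ^ (k + 1) / ((k : ℝ) + 2) ^ (k + 2) < b * a ^ (k + 1)) :
    ∃ v ∈ Set.Icc (0 : ℝ) 1, ∃ w ∈ Set.Icc (0 : ℝ) 1,
      v = a - b * w ^ (k + 2) ∧ w = a - b * v ^ (k + 2) ∧ v ≠ w := by
  have ha0 : 0 < a := by
    refine (hb.trans hba).lt_of_ne ?_
    rintro rfl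
    have : (0 : ℝ) ≤ ((k : ℝ) + 3) ^ (k + 1) / ((k : ℝ) + 2) ^ (k + 2) := by positivity
    simp at hab
    linarith
  rw [div_lt_iff₀ (by positivity)] at hab
  -- Its zeros are the ratios w / v compatible with the value of b a^{d-1}. A zero at ρ = 0 is
  -- allowed; ρ = 1 is excluded by the strict hypothesis.
  set F : ℝ → ℝ := fun ρ => b * a ^ (k + 1) * homogeneousSum 1 ρ (k + 1) ^ (k + 2) -
    homogeneousSum 1 ρ (k + 2) ^ (k + 1) with hF
  have hFc : Continuous F :=
    ((continuous_homogeneousSum 1 _).pow _).const_mul _ |>.sub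
      ((continuous_homogeneousSum 1 _).pow _)
  have hF1 : 0 < F 1 := by
    simp only [hF, homogeneousSum_one_one]
    push_cast
    rw [show (k : ℝ) + 1 + 1 = k + 2 by ring, show (k : ℝ) + 2 + 1 = k + 3 by ring]
    linarith
  have hF0 : F 0 ≤ 0 := by
    simp only [hF, homogeneousSum_one_zero, one_pow]
    have h1 : a ^ (k + 1) ≤ 1 := pow_le_one₀ ha0.le ha
    have h2 : b * a ^ (k + 1) ≤ 1 * 1 :=
      mul_le_mul (hba.trans ha) h1 (by positivity) zero_le_one
    linarith
  obtain ⟨ρ, ⟨hρ0, hρ1⟩, hρ⟩ := intermediate_value_Icc zero_le_one hFc.continuousOn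
    ⟨hF0, hF1.le⟩
  have hρne : ρ ≠ 1 := by
    rintro rfl
    linarith
  set h := homogeneousSum 1 ρ (k + 1) with hh
  set h' := homogeneousSum 1 ρ (k + 2) with hh'
  have hp : 0 < h := homogeneousSum_pos zero_le_one hρ0 (by linarith) _
  have hp' : 0 < h' := homogeneousSum_pos zero_le_one hρ0 (by linarith) _
  have e1 : h' = h + ρ ^ (k + 2) := by rw [hh', homogeneousSum_succ, one_mul]
  have e2 : h' = ρ * h + 1 := by rw [hh', homogeneousSum_succ', one_pow]
  have hρ' : b * a ^ (k + 1) * h ^ (k + 2) = h' ^ (k + 1) := sub_eq_zero.1 hρ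
  -- The scale v = a h / h' is forced by a h_{d-1}(v, ρv) = h_d(v, ρv).
  have hv : b * (a * h / h') ^ (k + 2) = a / h' := by
    rw [div_pow, mul_pow]
    field_simp
    linear_combination a * h' * hρ'
  have hv0 : 0 < a * h / h' := by positivity
  have c1 : a * h / h' = a - b * (ρ * (a * h / h')) ^ (k + 2) := by
    rw [mul_pow, mul_left_comm, hv]
    field_simp
    linear_combination -e1
  have c2 : ρ * (a * h / h') = a - b * (a * h / h') ^ (k + 2) := by
    rw [hv]
    field_simp
    linear_combination -e2
  refine ⟨a * h / h', ⟨hv0.le, ?_⟩, ρ * (a * h / h'), ⟨by positivity, ?_⟩, c1, c2, ?_⟩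
  · have : 0 ≤ b * (ρ * (a * h / h')) ^ (k + 2) := by positivity
    linarith
  · have : 0 ≤ b * (a * h / h') ^ (k + 2) := by positivity
    linarith
  · intro h
    exact hρne (mul_right_cancel₀ hv0.ne' (by rw [one_mul, ← h]))

/-- The antitone map `v ↦ a - b v ^ d` has a cycle of length two if and only if `b a ^ (d - 1)`
exceeds a threshold. -/
theorem two_cycle_sub_mul_pow_iff {a b : ℝ} {d : ℕ} (hd : 2 ≤ d) (hb : 0 ≤ b) (hba : b ≤ a)
    (ha : a ≤ 1) :
    (∀ v ∈ Set.Icc (0 : ℝ) 1, ∀ w ∈ Set.Icc (0 : ℝ) 1,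
      v = a - b * w ^ d → w = a - b * v ^ d → v = w) ↔
      b * a ^ (d - 1) ≤ ((d : ℝ) + 1) ^ (d - 1) / (d : ℝ) ^ d := by
  obtain ⟨k, rfl⟩ : ∃ k, d = k + 2 := ⟨d - 2, by omega⟩
  have e : ((k + 2 : ℕ) : ℝ) + 1 = (k : ℝ) + 3 := by
    push_cast
    ring
  rw [show k + 2 - 1 = k + 1 by omega, e, Nat.cast_add, Nat.cast_ofNat]
  constructor
  · intro h
    by_contra! hlt
    obtain ⟨v, hv, w, hw, h1, h2, hne⟩ := exists_two_cycle_sub_mul_pow hb hba ha hlt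
    exact hne (h v hv w hw h1 h2)
  · exact fun h v hv w hw h1 h2 => eq_of_two_cycle_sub_mul_pow hv.1 hw.1 h1 h2 h

/-- With r = k + 2, distinct points give A = C s t h_{r-2} and C s t h_{r-1} = 1. Hence A^{r+1} / C
= s t h_{r-2}^{r+1} / h_{r-1}^r, and `mul_pow_lt_pow_of_log_convex` with q = s t puts it strictly
below the threshold. -/
theorem eq_of_two_cycle_inv_pow {A C s t : ℝ} {k : ℕ} (hC : 0 ≤ C) (hs : 0 < s)
    (ht : 0 < t) (hst : s * (A + C * t ^ (k + 2)) = 1) (hts : t * (A + C * s ^ (k + 2)) = 1)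
    (hAC : ((k : ℝ) + 1) ^ (k + 3) * C ≤ A ^ (k + 3) * ((k : ℝ) + 2) ^ (k + 2)) : s = t := by
  by_contra hne
  have hpos : 0 < s + t := by positivity
  set h := homogeneousSum s t k with hh
  set h' := homogeneousSum s t (k + 1) with hh'
  have hp : 0 < h := homogeneousSum_pos hs.le ht.le hpos _
  have hp' : 0 < h' := homogeneousSum_pos hs.le ht.le hpos _
  have hA : A = C * (s * t) * h := by
    have := sub_mul_homogeneousSum s t k
    refine mul_left_cancel₀ (sub_ne_zero.2 hne) ?_
    linear_combination hst - hts - C * (s * t) * this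
  have h1 : C * (s * t) * h' = 1 := by
    have := homogeneousSum_succ s t k
    linear_combination C * (s * t) * this + hst - s * hA
  have hC0 : 0 < C := by
    refine hC.lt_of_ne ?_
    rintro rfl
    simp at h1
  have hAh : h = A * h' := by linear_combination -h * h1 - h' * hA
  have hq : s * t < homogeneousMean s t 1 ^ 2 := by
    simp only [homogeneousMean, homogeneousSum_succ, homogeneousSum_zero]
    have := sq_pos_of_ne_zero (sub_ne_zero.2 hne)
    norm_num
    linarith
  have key := mul_pow_lt_pow_of_log_convex (homogeneousMean_pos hs.le ht.le hpos)
    (homogeneousMean_sq_lt hs.le ht.le hne) (homogeneousMean_zero s t) (by positivity) hq k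
  simp only [homogeneousMean, ← hh, ← hh', div_pow] at key
  push_cast at key
  rw [show (k : ℝ) + 1 + 1 = k + 2 by ring, mul_div_assoc',
    div_lt_div_iff₀ (by positivity) (by positivity)] at key
  have key' := mul_lt_mul_of_pos_left key (mul_pos hC0 hp')
  have e1 : C * h' * (s * t * h ^ (k + 3) * ((k : ℝ) + 2) ^ (k + 2)) =
      A ^ (k + 3) * ((k : ℝ) + 2) ^ (k + 2) * h' ^ (k + 3) := by
    rw [hAh, mul_pow A]
    linear_combination A ^ (k + 3) * ((k : ℝ) + 2) ^ (k + 2) * h' ^ (k + 3) * h1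
  have e2 : C * h' * (h' ^ (k + 2) * ((k : ℝ) + 1) ^ (k + 3)) =
      ((k : ℝ) + 1) ^ (k + 3) * C * h' ^ (k + 3) := by ring
  rw [e1, e2] at key'
  exact absurd (lt_of_mul_lt_mul_right key' (by positivity)) hAC.not_gt

theorem exists_two_cycle_inv_pow {A C : ℝ} {k : ℕ} (hA : 0 < A)
    (hAC : A ^ (k + 3) * ((k : ℝ) + 2) ^ (k + 2) < ((k : ℝ) + 1) ^ (k + 3) * C) :
    ∃ s > 0, ∃ t > 0, s * (A + C * t ^ (k + 2)) = 1 ∧ t * (A + C * s ^ (k + 2)) = 1 ∧ s ≠ t := by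
  set F : ℝ → ℝ := fun ρ => C * ρ * homogeneousSum 1 ρ k ^ (k + 3) -
    A ^ (k + 3) * homogeneousSum 1 ρ (k + 1) ^ (k + 2) with hF
  have hFc : Continuous F :=
    ((continuous_const.mul continuous_id).mul ((continuous_homogeneousSum 1 _).pow _)).sub
      (((continuous_homogeneousSum 1 _).pow _).const_mul _)
  have hF1 : 0 < F 1 := by
    simp only [hF, homogeneousSum_one_one]
    push_cast
    rw [show (k : ℝ) + 1 + 1 = k + 2 by ring]
    linarith
  -- Strictness excludes ρ = 0, so that both points of the cycle are positive.
  have hF0 : F 0 < 0 := by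
    simp only [hF, homogeneousSum_one_zero, one_pow]
    have : 0 < A ^ (k + 3) := by positivity
    linarith
  obtain ⟨ρ, ⟨hρ0, hρ1⟩, hρ⟩ := intermediate_value_Icc zero_le_one hFc.continuousOn
    ⟨hF0.le, hF1.le⟩
  have hρne : ρ ≠ 1 := by
    rintro rfl
    linarith
  have hρpos : 0 < ρ := by
    refine hρ0.lt_of_ne ?_
    rintro rfl
    linarith
  set h := homogeneousSum 1 ρ k with hh
  set h' := homogeneousSum 1 ρ (k + 1) with hh'
  have hp : 0 < h := homogeneousSum_pos zero_le_one hρ0 (by linarith) _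
  have hp' : 0 < h' := homogeneousSum_pos zero_le_one hρ0 (by linarith) _
  have e1 : h' = h + ρ ^ (k + 1) := by rw [hh', homogeneousSum_succ, one_mul]
  have e2 : h' = ρ * h + 1 := by rw [hh', homogeneousSum_succ', one_pow]
  have hρ' : C * ρ * h ^ (k + 3) = A ^ (k + 3) * h' ^ (k + 2) := sub_eq_zero.1 hρ
  -- The scale forced by A h_{r-1}(s, ρs) = h_{r-2}(s, ρs).
  set s := h / (A * h') with hs
  have hs0 : 0 < s := by positivity
  have hsA : s * A = h / h' := by
    rw [hs]
    field_simp
  have hsC : C * ρ * s ^ (k + 3) = 1 / h' := by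
    rw [hs, div_pow, mul_pow]
    field_simp
    linear_combination h' * hρ'
  refine ⟨s, hs0, ρ * s, by positivity, ?_, ?_, ?_⟩
  · have : s * (A + C * (ρ * s) ^ (k + 2)) = s * A + ρ ^ (k + 1) * (C * ρ * s ^ (k + 3)) := by
      ring
    rw [this, hsA, hsC]
    field_simp
    linear_combination -e1
  · have : ρ * s * (A + C * s ^ (k + 2)) = ρ * (s * A) + C * ρ * s ^ (k + 3) := by ring
    rw [this, hsA, hsC]
    field_simp
    linear_combination -e2
  · intro h
    exact hρne (mul_right_cancel₀ hs0.ne' (by rw [one_mul, ← h]))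

/-- The antitone map `s ↦ 1 / (A + C s ^ r)` has a cycle of length two if and only if
`C / A ^ (r + 1)` exceeds a threshold. -/
theorem two_cycle_inv_pow_iff {A C : ℝ} {r : ℕ} (hr : 1 ≤ r) (hA : 0 < A) (hC : 0 ≤ C) :
    (∀ s > 0, ∀ t > 0, s * (A + C * t ^ r) = 1 → t * (A + C * s ^ r) = 1 → s = t) ↔
      ((r : ℝ) - 1) ^ (r + 1) * C ≤ A ^ (r + 1) * (r : ℝ) ^ r := by
  rcases hr.eq_or_lt with rfl | hr
  -- For r = 1 the threshold condition always holds, and the two equations share the term C s t, so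
  -- s A = t A.
  · constructor
    · intro _
      norm_num
      positivity
    · intro _ s _ t _ h1 h2
      refine mul_right_cancel₀ hA.ne' ?_
      linear_combination h1 - h2
  obtain ⟨k, rfl⟩ : ∃ k, r = k + 2 := ⟨r - 2, by omega⟩
  have e : ((k + 2 : ℕ) : ℝ) - 1 = (k : ℝ) + 1 := by
    push_cast
    ring
  rw [e, Nat.cast_add, Nat.cast_ofNat]
  constructor
  · intro h
    by_contra! hlt
    obtain ⟨s, hs, t, ht, h1, h2, hne⟩ := exists_two_cycle_inv_pow hA hlt
    exact hne (h s hs t ht h1 h2)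
  · exact fun h s hs t ht h1 h2 => eq_of_two_cycle_inv_pow hC hs ht h1 h2 h

/-- The derivative log x - 1 + 1/x is positive except at x = 1, which is why the half-line is cut
there. -/
theorem strictMonoOn_mul_log_sub :
    StrictMonoOn (fun x : ℝ => x * Real.log x - 2 * x + Real.log x) (Set.Ioi 0) := by
  have hd : ∀ x : ℝ, 0 < x → HasDerivAt
      (fun x : ℝ => x * Real.log x - 2 * x + Real.log x) (Real.log x + 1 - 2 * 1 + x⁻¹) x :=
    fun x hx => ((Real.hasDerivAt_mul_log hx.ne').sub ((hasDerivAt_id x).const_mul 2)).add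
      (Real.hasDerivAt_log hx.ne')
  have hc : ContinuousOn (fun x : ℝ => x * Real.log x - 2 * x + Real.log x) (Set.Ioi 0) :=
    fun x hx => (hd x hx).continuousAt.continuousWithinAt
  have hderiv : ∀ x : ℝ, 0 < x → x ≠ 1 →
      0 < deriv (fun x : ℝ => x * Real.log x - 2 * x + Real.log x) x := by
    intro x hx hx1
    rw [(hd x hx).deriv]
    have := Real.log_lt_sub_one_of_pos (inv_pos.2 hx) (by simpa using hx1)
    rw [Real.log_inv] at this
    linarith
  have h1 : StrictMonoOn (fun x : ℝ => x * Real.log x - 2 * x + Real.log x) (Set.Ioc 0 1) :=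
    strictMonoOn_of_deriv_pos (convex_Ioc 0 1) (hc.mono fun x hx => hx.1) fun x hx => by
      rw [interior_Ioc] at hx
      exact hderiv x hx.1 hx.2.ne
  have h2 : StrictMonoOn (fun x : ℝ => x * Real.log x - 2 * x + Real.log x) (Set.Ici 1) :=
    strictMonoOn_of_deriv_pos (convex_Ici 1)
      (hc.mono fun x hx => Set.mem_Ioi.2 (zero_lt_one.trans_le hx)) fun x hx => by
      rw [interior_Ici] at hx
      exact hderiv x (zero_lt_one.trans hx) (ne_of_gt hx)
  have := h1.union h2 (isGreatest_Ioc zero_lt_one) isLeast_Ici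
  rwa [Set.Ioc_union_Ici_eq_Ioi zero_lt_one] at this

/-- On a cycle, the values of x log x - 2x + log x at `U` and `W` differ by (U - W)(log c - 1). -/
theorem one_lt_log_of_two_cycle {c U W : ℝ} (hU : 0 < U) (hW : 0 < W)
    (hUW : Real.log U = Real.log c - W) (hWU : Real.log W = Real.log c - U) (h : W < U) :
    1 < Real.log c := by
  have := strictMonoOn_mul_log_sub hW hU h
  simp only [hUW, hWU] at this
  refine lt_of_mul_lt_mul_left (a := U - W) ?_ (sub_pos.2 h).le
  linarith

theorem exists_gt_of_hasDerivAt_pos {f : ℝ → ℝ} {f' x : ℝ} (h : HasDerivAt f f' x)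
    (hf' : 0 < f') : ∃ y > x, f x < f y := by
  have hs := (hasDerivAt_iff_tendsto_slope_left_right.1 h).2
  obtain ⟨y, hy, hxy⟩ := ((hs.eventually (lt_mem_nhds hf')).and self_mem_nhdsWithin).exists
  refine ⟨y, hxy, ?_⟩
  rw [slope_def_field] at hy
  have := (div_pos_iff_of_pos_right (sub_pos.2 hxy)).1 hy
  linarith

/-- The fixed point u of φ(x) = c exp(-x) exceeds 1, and φ∘φ has slope u² > 1 there. So φ∘φ rises
above the diagonal to the right of u; being bounded by c on the half-line, it meets the diagonal
again at some z > u, and φ(z) < u < z. -/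
theorem exists_two_cycle_exp {c : ℝ} (hc : Real.exp 1 < c) :
    ∃ U W, U = c * Real.exp (-W) ∧ W = c * Real.exp (-U) ∧ U ≠ W := by
  have hc0 : 0 < c := (Real.exp_pos 1).trans hc
  have hc1 : 1 < c := (Real.one_lt_exp_iff.2 one_pos).trans hc
  set φ : ℝ → ℝ := fun x => c * Real.exp (-x) with hφ
  have hφc : Continuous φ := by fun_prop
  have hφa : StrictAnti φ := fun x y hxy =>
    mul_lt_mul_of_pos_left (Real.exp_lt_exp.2 (neg_lt_neg hxy)) hc0
  have hφd : ∀ x, HasDerivAt φ (-φ x) x := by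
    intro x
    have := ((hasDerivAt_neg x).exp).const_mul c
    rwa [mul_neg_one, mul_neg] at this
  obtain ⟨u, ⟨hu1, -⟩, hu⟩ : ∃ u ∈ Set.Icc 1 c, φ u - u = 0 := by
    refine intermediate_value_Icc' hc1.le (by fun_prop) ⟨?_, ?_⟩
    · have : c * Real.exp (-c) ≤ c * 1 :=
        mul_le_mul_of_nonneg_left (Real.exp_le_one_iff.2 (by linarith)) hc0.le
      simp only [hφ]
      linarith
    · have : Real.exp 1 * Real.exp (-1) ≤ c * Real.exp (-1) :=
        mul_le_mul_of_nonneg_right hc.le (Real.exp_pos _).le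
      rw [← Real.exp_add, add_neg_cancel, Real.exp_zero] at this
      simp only [hφ]
      linarith
  have hfix : φ u = u := sub_eq_zero.1 hu
  have hu1' : 1 < u := by
    refine hu1.lt_of_ne ?_
    rintro rfl
    have : c * (Real.exp (-1) * Real.exp 1) = 1 * Real.exp 1 := by
      rw [← mul_assoc]
      congr 1
    rw [← Real.exp_add, neg_add_cancel, Real.exp_zero] at this
    linarith
  have hd : HasDerivAt (fun x => φ (φ x) - x) (-φ (φ u) * -φ u - 1) u :=
    ((hφd (φ u)).comp u (hφd u)).sub (hasDerivAt_id u)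
  obtain ⟨y, hy, hψ⟩ := exists_gt_of_hasDerivAt_pos hd (by rw [hfix, hfix]; nlinarith)
  simp only [hfix, sub_self] at hψ
  have hφle : ∀ x, 0 ≤ x → φ x ≤ c := fun x hx => by
    have : c * Real.exp (-x) ≤ c * 1 :=
      mul_le_mul_of_nonneg_left (Real.exp_le_one_iff.2 (by linarith)) hc0.le
    simpa [hφ] using this
  obtain ⟨z, ⟨hz, -⟩, hz0⟩ : ∃ z ∈ Set.Icc y (c + y), φ (φ z) - z = 0 := by
    refine intermediate_value_Icc' (by linarith) (by fun_prop) ⟨?_, hψ.le⟩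
    have := hφle (φ (c + y)) (by positivity)
    linarith
  refine ⟨z, φ z, (sub_eq_zero.1 hz0).symm, rfl, ?_⟩
  have := hφa (hy.trans_le hz)
  rw [hfix] at this
  exact (this.trans (hy.trans_le hz)).ne'

/-- The antitone map `U ↦ c exp (-U)` has a cycle of length two if and only if `c` exceeds `e`. -/
theorem two_cycle_exp_iff {c : ℝ} (hc : 0 ≤ c) :
    (∀ U W, U = c * Real.exp (-W) → W = c * Real.exp (-U) → U = W) ↔ c ≤ Real.exp 1 := by
  constructor
  · intro h
    by_contra! hlt
    obtain ⟨U, W, h1, h2, hne⟩ := exists_two_cycle_exp hlt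
    exact hne (h U W h1 h2)
  · intro h U W hUW hWU
    rcases hc.eq_or_lt with rfl | hc
    · rw [zero_mul] at hUW hWU
      rw [hUW, hWU]
    have hU : 0 < U := by rw [hUW]; positivity
    have hW : 0 < W := by rw [hWU]; positivity
    have hlog : ∀ x y, x = c * Real.exp (-y) → Real.log x = Real.log c - y := by
      rintro x y rfl
      rw [Real.log_mul hc.ne' (Real.exp_ne_zero _), Real.log_exp]
      ring
    have hle : Real.log c ≤ 1 := (Real.log_le_iff_le_exp hc).2 h
    rcases lt_trichotomy U W with h' | h' | h'
    · exact absurd (one_lt_log_of_two_cycle hW hU (hlog _ _ hWU) (hlog _ _ hUW) h') hle.not_gt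
    · exact h'
    · exact absurd (one_lt_log_of_two_cycle hU hW (hlog _ _ hUW) (hlog _ _ hWU) h') hle.not_gt

/-! ### Generating functions of the offspring distributions -/

theorem generatingFunction_binomial (d : ℕ) (π : unitInterval) (s : ℝ) :
    generatingFunction (binomial d π) s = (1 - π + π * s) ^ d := by
  rw [generatingFunction, integral_binomial, add_comm (1 - (π : ℝ)), add_pow,
    ← Nat.range_succ_eq_Iic]
  refine Finset.sum_congr rfl fun k _ => ?_
  rw [smul_eq_mul, mul_pow]
  ring

theorem generatingFunction_poisson (lam : NNReal) (s : ℝ) :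
    generatingFunction (poissonMeasure lam) s = Real.exp (lam * (s - 1)) := by
  rw [generatingFunction, integral_poissonMeasure]
  have h : ∀ n : ℕ, (Real.exp (-lam) * (lam : ℝ) ^ n / n.factorial) • s ^ n =
      Real.exp (-lam) * ((lam * s) ^ n / n.factorial) := fun n => by
    rw [smul_eq_mul, mul_pow]
    ring
  rw [tsum_congr h, tsum_mul_left, (NormedSpace.expSeries_div_hasSum_exp (lam * s : ℝ)).tsum_eq,
    ← Real.exp_eq_exp_ℝ, ← Real.exp_add]
  ring_nf

theorem generatingFunction_negativeBinomial {r : ℕ} (hr : 1 ≤ r) {π : unitInterval}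
    (hπ : 0 < (π : ℝ)) {s : ℝ} (hs : s ∈ Set.Icc (0 : ℝ) 1) :
    generatingFunction (negativeBinomial r π) s = (π : ℝ) ^ r / (1 - (1 - π) * s) ^ r := by
  obtain ⟨k, rfl⟩ : ∃ k, r = k + 1 := ⟨r - 1, by omega⟩
  have hπ1 : (π : ℝ) ≤ 1 := π.2.2
  rw [generatingFunction, negativeBinomial, integral_sum_dirac (by simp)]
  have h : ∀ n : ℕ, (ENNReal.ofReal (((n + (k + 1) - 1).choose n : ℝ) * (π : ℝ) ^ (k + 1) *
      (1 - (π : ℝ)) ^ n)).toReal • s ^ n =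
      (π : ℝ) ^ (k + 1) * (((n + k).choose k : ℝ) * ((1 - π) * s) ^ n) := fun n => by
    have h1 : (0 : ℝ) ≤ 1 - π := by linarith
    rw [ENNReal.toReal_ofReal (by positivity), show n + (k + 1) - 1 = n + k by omega,
      Nat.choose_symm_add, smul_eq_mul, mul_pow]
    ring
  have h0 : 0 ≤ (1 - (π : ℝ)) * s := mul_nonneg (by linarith) hs.1
  have h1 : (1 - (π : ℝ)) * s < 1 := by nlinarith [hs.1, hs.2]
  rw [tsum_congr h, tsum_mul_left, tsum_choose_mul_geometric_of_norm_lt_one k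
    (by rwa [Real.norm_of_nonneg h0]), mul_one_div]

theorem generatingFunction_bernoulli (d : ℕ) (π : unitInterval) (s : ℝ) :
    generatingFunction (bernoulliMeasure d 0 π) s = 1 - π + π * s ^ d := by
  rw [generatingFunction, integral_bernoulliMeasure]
  simp only [smul_eq_mul, pow_zero]
  ring

/-! ### The thresholds -/

theorem one_sub_pow_mem_Icc {v : ℝ} (hv : v ∈ Set.Icc (0 : ℝ) 1) (d : ℕ) :
    1 - v ^ d ∈ Set.Icc (0 : ℝ) 1 :=
  one_sub_mem_Icc ⟨pow_nonneg hv.1 d, pow_le_one₀ hv.1 hv.2⟩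

/-- Here Φ = g ∘ f with f affine and g(v) = 1 - v^d. The cycles of g ∘ f and f ∘ g correspond, and f
∘ g is v ↦ a - b v^d with a = 1 - π p₁, b = π p₀. -/
theorem drawProbability_binomial_eq_zero_iff (p : EdgeProbabilities) {d : ℕ} (hd : 2 ≤ d)
    (π : unitInterval) :
    drawProbability (binomial d π) p 2 1 1 = 0 ↔
      (1 - p.neg - p.pos) * (π : ℝ) * (1 - (π : ℝ) * p.pos) ^ (d - 1) ≤
        ((d : ℝ) + 1) ^ (d - 1) / (d : ℝ) ^ d := by
  have hπ0 : (0 : ℝ) ≤ π := π.2.1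
  have hπ1 : (π : ℝ) ≤ 1 := π.2.2
  have hz : 1 - p.neg - p.pos = p.zero := by linarith [p.sum_eq_one]
  have hz1 : p.zero ≤ 1 - p.pos := by linarith [p.neg_nonneg, p.sum_eq_one]
  rw [drawProbability_eq_zero_iff, hz, mul_comm p.zero, ← two_cycle_sub_mul_pow_iff hd
    (mul_nonneg hπ0 p.zero_nonneg) (by nlinarith) (by nlinarith [mul_nonneg hπ0 p.pos_nonneg])]
  simp only [generatingFunction_binomial]
  set f : ℝ → ℝ := fun x => 1 - π + π * (p.neg + p.zero * x) with hf
  have hfmem : ∀ x ∈ Set.Icc (0 : ℝ) 1, f x ∈ Set.Icc (0 : ℝ) 1 := by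
    intro x hx
    obtain ⟨h0, h1⟩ := neg_add_zero_mul_mem_Icc (p := p) hx
    constructor <;> simp only [hf] <;> nlinarith
  have hfsub : ∀ v, f (1 - v) = 1 - π * p.pos - π * p.zero * v := by
    intro v
    simp only [hf]
    linear_combination (π : ℝ) * p.sum_eq_one
  constructor
  · intro h v hv w hw hvw hwv
    have h1 := hfsub (w ^ d)
    have h2 := hfsub (v ^ d)
    rw [← hvw] at h1
    rw [← hwv] at h2
    have := h (1 - w ^ d) (one_sub_pow_mem_Icc hw d) (1 - v ^ d) (one_sub_pow_mem_Icc hv d)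
      (by change _ = 1 - f _ ^ d; rw [h2]) (by change _ = 1 - f _ ^ d; rw [h1])
    rw [← h1, this, h2]
  · intro h x hx y hy hxy hyx
    change x = 1 - f y ^ d at hxy
    change y = 1 - f x ^ d at hyx
    have := h (f x) (hfmem x hx) (f y) (hfmem y hy)
      (by rw [← hfsub, ← hxy]) (by rw [← hfsub, ← hyx])
    -- For p₀ = 0 the map f is not injective; equality of x and y comes from the cycle equations
    -- instead.
    rw [← this] at hxy
    exact hxy.trans hyx.symm

/-- The same exchange of factors, now with g(v) = π (1 - v^d) and f(x) = p₋₁ + p₀ x, gives a = p₋₁ +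
p₀ π and b = p₀ π. -/
theorem drawProbability_bernoulli_eq_zero_iff (p : EdgeProbabilities) {d : ℕ} (hd : 2 ≤ d)
    (π : unitInterval) :
    drawProbability (bernoulliMeasure d 0 π) p 2 1 1 = 0 ↔
      (1 - p.neg - p.pos) * (π : ℝ) *
          ((π : ℝ) * (1 - p.pos) + p.neg * (1 - (π : ℝ))) ^ (d - 1) ≤
        ((d : ℝ) + 1) ^ (d - 1) / (d : ℝ) ^ d := by
  have hπ0 : (0 : ℝ) ≤ π := π.2.1
  have hπ1 : (π : ℝ) ≤ 1 := π.2.2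
  have hz : 1 - p.neg - p.pos = p.zero := by linarith [p.sum_eq_one]
  have ha : (π : ℝ) * (1 - p.pos) + p.neg * (1 - (π : ℝ)) = p.neg + p.zero * π := by
    linear_combination (-π : ℝ) * p.sum_eq_one
  have hmem : ∀ x ∈ Set.Icc (0 : ℝ) 1, p.neg + p.zero * x ∈ Set.Icc (0 : ℝ) 1 :=
    fun x hx => neg_add_zero_mul_mem_Icc hx
  rw [drawProbability_eq_zero_iff, hz, ha, ← two_cycle_sub_mul_pow_iff hd
    (mul_nonneg p.zero_nonneg hπ0) (by linarith [p.neg_nonneg]) (hmem π ⟨hπ0, hπ1⟩).2]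
  simp only [generatingFunction_bernoulli]
  set f : ℝ → ℝ := fun x => p.neg + p.zero * x with hf
  have hfsub : ∀ v, f (π * (1 - v)) = f π - p.zero * π * v := by
    intro v
    simp only [hf]
    ring
  have hpow : ∀ v ∈ Set.Icc (0 : ℝ) 1, (π : ℝ) * (1 - v ^ d) ∈ Set.Icc (0 : ℝ) 1 := by
    intro v hv
    obtain ⟨h0, h1⟩ := one_sub_pow_mem_Icc hv d
    exact ⟨mul_nonneg hπ0 h0, mul_le_one₀ hπ1 h0 h1⟩
  constructor
  · intro h v hv w hw hvw hwv
    have h1 := hfsub (w ^ d)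
    have h2 := hfsub (v ^ d)
    rw [← hvw] at h1
    rw [← hwv] at h2
    have := h (π * (1 - w ^ d)) (hpow w hw) (π * (1 - v ^ d)) (hpow v hv)
      (by change _ = 1 - (1 - π + π * f _ ^ d); rw [h2]; ring)
      (by change _ = 1 - (1 - π + π * f _ ^ d); rw [h1]; ring)
    rw [← h1, this, h2]
  · intro h x hx y hy hxy hyx
    have hxy' : x = π * (1 - f y ^ d) := by linear_combination hxy
    have hyx' : y = π * (1 - f x ^ d) := by linear_combination hyx
    have := h (f x) (hmem x hx) (f y) (hmem y hy)
      (by change _ = f π - _; rw [← hfsub, ← hxy']) (by change _ = f π - _; rw [← hfsub, ← hyx'])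
    rw [← this] at hxy'
    exact hxy'.trans hyx'.symm

/-- In the variable U = p₀ λ (1 - x), Φ becomes U ↦ c exp(-U) with c = p₀ λ exp(-λ p₁). -/
theorem drawProbability_poisson_eq_zero_iff (p : EdgeProbabilities) (lam : NNReal) :
    drawProbability (poissonMeasure lam) p 2 1 1 = 0 ↔
      (1 - p.neg - p.pos) * (lam : ℝ) * Real.exp (-((lam : ℝ) * p.pos)) ≤ Real.exp 1 := by
  have hl : (0 : ℝ) ≤ lam := lam.2
  have hz : 1 - p.neg - p.pos = p.zero := by linarith [p.sum_eq_one]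
  have hz0 := p.zero_nonneg
  set a : ℝ := Real.exp (-((lam : ℝ) * p.pos)) with ha
  have ha1 : a ≤ 1 := Real.exp_le_one_iff.2 (by linarith [mul_nonneg hl p.pos_nonneg])
  rw [drawProbability_eq_zero_iff, hz, ← two_cycle_exp_iff (by positivity)]
  simp only [generatingFunction_poisson]
  have hexp : ∀ x, Real.exp (lam * (p.neg + p.zero * x - 1)) =
      a * Real.exp (-(p.zero * lam * (1 - x))) := by
    intro x
    rw [ha, ← Real.exp_add]
    congr 1
    linear_combination (lam : ℝ) * p.sum_eq_one
  simp only [hexp]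
  constructor
  · intro h U W hUW hWU
    have hmem : ∀ V : ℝ, 0 ≤ V → 1 - a * Real.exp (-V) ∈ Set.Icc (0 : ℝ) 1 := fun V hV =>
      one_sub_mem_Icc ⟨by positivity,
        mul_le_one₀ ha1 (Real.exp_pos _).le (Real.exp_le_one_iff.2 (by linarith))⟩
    have hU : p.zero * lam * (1 - (1 - a * Real.exp (-W))) = U := by linear_combination -hUW
    have hW : p.zero * lam * (1 - (1 - a * Real.exp (-U))) = W := by linear_combination -hWU
    have := h _ (hmem W (by rw [hWU]; positivity)) _ (hmem U (by rw [hUW]; positivity))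
      (by rw [hW]) (by rw [hU])
    rw [← hU, this, hW]
  · intro h x _ y _ hxy hyx
    have := h (p.zero * lam * (1 - x)) (p.zero * lam * (1 - y))
      (by linear_combination -(p.zero * lam) * hxy) (by linear_combination -(p.zero * lam) * hyx)
    rw [← this] at hxy
    exact hxy.trans hyx.symm

/-- In the variable s = 1 / (A + B (1 - x)), where B = (1 - π) p₀, the generating function is (π
s)^r, and Φ becomes s ↦ 1 / (A + C s^r) with C = B π^r. -/
theorem drawProbability_negativeBinomial_eq_zero_iff (p : EdgeProbabilities) {r : ℕ} (hr : 1 ≤ r)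
    {π : unitInterval} (hπ : 0 < (π : ℝ)) :
    drawProbability (negativeBinomial r π) p 2 1 1 = 0 ↔
      ((r : ℝ) - 1) ^ (r + 1) * (1 - (π : ℝ)) * (1 - p.neg - p.pos) * (π : ℝ) ^ r ≤
        (p.pos + (π : ℝ) - p.pos * (π : ℝ)) ^ (r + 1) * (r : ℝ) ^ r := by
  have := isProbabilityMeasure_negativeBinomial r hr π hπ
  have hπ1 : (0 : ℝ) ≤ 1 - π := by linarith [π.2.2]
  have hz : 1 - p.neg - p.pos = p.zero := by linarith [p.sum_eq_one]
  have hz0 := p.zero_nonneg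
  set A : ℝ := p.pos + π - p.pos * π with hA
  have hAπ : (π : ℝ) ≤ A := by
    have := mul_nonneg p.pos_nonneg hπ1
    linarith
  have hA0 : 0 < A := hπ.trans_le hAπ
  set C : ℝ := (1 - π) * p.zero * (π : ℝ) ^ r with hC
  have hC0 : 0 ≤ C := by positivity
  have hassoc : ((r : ℝ) - 1) ^ (r + 1) * (1 - (π : ℝ)) * p.zero * (π : ℝ) ^ r =
    ((r : ℝ) - 1) ^ (r + 1) * C := by rw [hC]; ring
  rw [drawProbability_eq_zero_iff, hz, hassoc, ← two_cycle_inv_pow_iff hr hA0 hC0]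
  set B : ℝ := (1 - π) * p.zero with hB
  have hB0 : 0 ≤ B := mul_nonneg hπ1 hz0
  have hG : ∀ x ∈ Set.Icc (0 : ℝ) 1,
      generatingFunction (negativeBinomial r π) (p.neg + p.zero * x) =
        (π * (A + B * (1 - x))⁻¹) ^ r := by
    intro x hx
    rw [generatingFunction_negativeBinomial hr hπ (neg_add_zero_mul_mem_Icc hx), ← div_pow,
      div_eq_mul_inv]
    congr 3
    rw [hA, hB]
    linear_combination (π - 1 : ℝ) * p.sum_eq_one
  have hpos : ∀ x ∈ Set.Icc (0 : ℝ) 1, 0 < A + B * (1 - x) := fun x hx => by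
    have := mul_nonneg hB0 (one_sub_mem_Icc hx).1
    linarith
  constructor
  · intro h s hs t ht hst hts
    have hmem : ∀ s t : ℝ, 0 < s → 0 < t → s * (A + C * t ^ r) = 1 →
        1 - (π * s) ^ r ∈ Set.Icc (0 : ℝ) 1 := by
      intro s t hs ht hst
      have h1 : π * s ≤ 1 := by
        have h2 : 0 ≤ s * (C * t ^ r) := by positivity
        have h3 := mul_le_mul_of_nonneg_right hAπ hs.le
        linarith
      exact one_sub_pow_mem_Icc ⟨by positivity, h1⟩ r
    have hinv : ∀ s t : ℝ, s * (A + C * t ^ r) = 1 →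
        (A + B * (1 - (1 - (π * t) ^ r)))⁻¹ = s := by
      intro s t hst
      rw [eq_inv_of_mul_eq_one_left hst, hC]
      congr 1
      ring
    have hs' := hmem s t hs ht hst
    have ht' := hmem t s ht hs hts
    have := h _ hs' _ ht' (by rw [hG _ ht', hinv s t hst]) (by rw [hG _ hs', hinv t s hts])
    rw [← hinv s t hst, ← this, hinv t s hts]
  · intro h x hx y hy hxy hyx
    rw [hG y hy] at hxy
    rw [hG x hx] at hyx
    have := h _ (inv_pos.2 (hpos x hx)) _ (inv_pos.2 (hpos y hy)) (by
      have : A + C * (A + B * (1 - y))⁻¹ ^ r = A + B * (1 - x) := by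
        rw [mul_pow] at hxy
        linear_combination B * hxy
      rw [this, inv_mul_cancel₀ (hpos x hx).ne']) (by
      have : A + C * (A + B * (1 - x))⁻¹ ^ r = A + B * (1 - y) := by
        rw [mul_pow] at hyx
        linear_combination B * hyx
      rw [this, inv_mul_cancel₀ (hpos y hy).ne'])
    rw [← this] at hxy
    exact hxy.trans hyx.symm

end PercolationGame

theorem theorem4 (p : PercolationGame.EdgeProbabilities) :
    (∀ (d : ℕ) (π : unitInterval), 2 ≤ d → 0 < (π : ℝ) →
      (PercolationGame.drawProbability (ProbabilityTheory.binomial d π) p 2 1 1 = 0 ↔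
        (1 - p.neg - p.pos) * (π : ℝ) * (1 - (π : ℝ) * p.pos) ^ (d - 1) ≤
          ((d : ℝ) + 1) ^ (d - 1) / (d : ℝ) ^ d)) ∧
    (∀ lam : NNReal, 0 < lam →
      (PercolationGame.drawProbability (ProbabilityTheory.poissonMeasure lam) p 2 1 1 = 0 ↔
        (1 - p.neg - p.pos) * (lam : ℝ) * Real.exp (-((lam : ℝ) * p.pos)) ≤ Real.exp 1)) ∧
    (∀ (r : ℕ) (π : unitInterval), 1 ≤ r → 0 < (π : ℝ) →
      (PercolationGame.drawProbability (PercolationGame.negativeBinomial r π) p 2 1 1 = 0 ↔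
        ((r : ℝ) - 1) ^ (r + 1) * (1 - (π : ℝ)) * (1 - p.neg - p.pos) * (π : ℝ) ^ r ≤
          (p.pos + (π : ℝ) - p.pos * (π : ℝ)) ^ (r + 1) * (r : ℝ) ^ r)) ∧
    (∀ (d : ℕ) (π : unitInterval), 2 ≤ d → 0 < (π : ℝ) → (π : ℝ) < 1 →
      (PercolationGame.drawProbability (ProbabilityTheory.bernoulliMeasure d 0 π) p 2 1 1 = 0 ↔
        (1 - p.neg - p.pos) * (π : ℝ) *
            ((π : ℝ) * (1 - p.pos) + p.neg * (1 - (π : ℝ))) ^ (d - 1) ≤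
          ((d : ℝ) + 1) ^ (d - 1) / (d : ℝ) ^ d)) := by
  refine ⟨fun d π hd _ => ?_, fun lam _ => ?_, fun r π hr hπ => ?_, fun d π hd _ _ => ?_⟩
  · exact PercolationGame.drawProbability_binomial_eq_zero_iff p hd π
  · exact PercolationGame.drawProbability_poisson_eq_zero_iff p lam
  · exact PercolationGame.drawProbability_negativeBinomial_eq_zero_iff p hr hπ
  · exact PercolationGame.drawProbability_bernoulli_eq_zero_iff p hd π
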